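/- Let $Y$ be an infinite-dimensional real Banach space, let $B_{Y^*}$ be the closed unit ball of $Y^*$, and equip $B_{Y^*}$ and its multiples $r\cdot B_{Y^*}$ with the weak$^*$ topology. Let $\omega$ be the discrete space of natural numbers, $\beta\omega$ its Čech–Stone compactification, and $\omega^*=\beta\omega\setminus\omega$. The following are equivalent: (i) $\mathrm{Ext}(Y,c_0)=0$, that is, for every short exact sequence $0\to c_0\xrightarrow{\,i\,} X\to Y\to 0$ of Banach spaces and bounded operators, the map $i$ has a bounded linear left inverse $X\to c_0$; (ii) there is a constant $r>0$ with $B_{Y^*}\subseteq r\cdot B_{Y^*}$ such that for every compact Hausdorff space $L\supseteq B_{Y^*}$ (containing $B_{Y^*}$ as a topological subspace) for which $L\setminus B_{Y^*}$ is a countably infinite discrete set, the inclusion $B_{Y^*}\to r\cdot B_{Y^*}$ extends to a homeomorphic embedding $L\to r\cdot B_{Y^*}$; (iii) there is a constant $r>0$ such that every continuous function $\omega^*\to B_{Y^*}$ extends to a continuous function $\beta\omega\to r\cdot B_{Y^*}$; (iv) there is a constant $r>0$ such that for every bounded operator $T:Y\to\ell_\infty/c_0$ there is a bounded operator $\widetilde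 T:Y\to\ell_\infty$ with $Q\widetilde T=T$ and $\|\widetilde T\|\le r\|T\|$, where $Q:\ell_\infty\to\ell_\infty/c_0$ is the quotient map. -/

import Mathlib

universe u v w

noncomputable section

open Topology Filter
open scoped ENNReal

/-- The real Banach space `ℓ_∞` of bounded real sequences with the supremum norm. -/
abbrev EllInfty : Type := lp (fun _ : ℕ => ℝ) ∞

/-- The space `c₀` of real sequences converging to `0`, as a subspace of `ℓ_∞`. -/
def cZero : Submodule ℝ EllInfty where
  carrier := {x | Tendsto (fun n : ℕ => x n) atTop (𝓝 0)}
  zero_mem' := by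
    simp only [Set.mem_ofPred_eq, lp.coeFn_zero, Pi.zero_apply]
    exact tendsto_const_nhds
  add_mem' := by
    intro a b ha hb
    simpa using Tendsto.add ha hb
  smul_mem' := by
    intro c a ha
    simpa using Tendsto.const_mul c ha

/-- `0 → A → X → Z → 0` (with maps `i` and `p`) is a short exact sequence of Banach spaces and
bounded operators. Completeness of the spaces is assumed where this is used. -/
structure IsTwistedSum {A : Type v} {X : Type w} {Z : Type u}
    [NormedAddCommGroup A] [NormedSpace ℝ A] [NormedAddCommGroup X] [NormedSpace ℝ X]
    [NormedAddCommGroup Z] [NormedSpace ℝ Z] (i : A →L[ℝ] X) (p : X →L[ℝ] Z) : Prop where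
  injective : Function.Injective i
  exact : Function.Exact i p
  surjective : Function.Surjective p

/-- `Ext(Z, A) = 0`: every short exact sequence `0 → A → X → Z → 0` with `X` a Banach space
splits, i.e. the map `A → X` has a bounded linear left inverse. (Any such `X` has the cardinality
of `A × Z`, so the universe of `X` is no restriction.) -/
def ExtVanishes (Z : Type u) (A : Type v) [NormedAddCommGroup Z] [NormedSpace ℝ Z]
    [NormedAddCommGroup A] [NormedSpace ℝ A] : Prop :=
  ∀ (X : Type (max u v)) [NormedAddCommGroup X] [NormedSpace ℝ X] [CompleteSpace X]
    (i : A →L[ℝ] X) (p : X →L[ℝ] Z), IsTwistedSum i p →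
      ∃ q : X →L[ℝ] A, ∀ a : A, q (i a) = a

/-- `L`, with `K` identified with its image under the embedding `e`, is a countable discrete
extension of the compact space `K`: it is a compact Hausdorff space and `L \ K` is a countably
infinite discrete set. -/
structure IsCountableDiscreteExtension {K : Type v} {L : Type w} [TopologicalSpace K]
    [TopologicalSpace L] (e : K → L) : Prop where
  compactSpace : CompactSpace L
  t2Space : T2Space L
  isEmbedding : IsEmbedding e
  countable : ((Set.range e)ᶜ).Countable
  infinite : ((Set.range e)ᶜ).Infinite
  discrete : IsDiscrete (Set.range e)ᶜ

/-- The extension `L` of `K` (via `e`) can be realized inside the superspace `Z` of `K` (via `j`):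
the inclusion `j : K → Z` extends to a homeomorphic embedding `L → Z`. -/
def CanBeRealizedInside {K : Type u} {L : Type v} {Z : Type w} [TopologicalSpace K]
    [TopologicalSpace L] [TopologicalSpace Z] (e : K → L) (j : K → Z) : Prop :=
  ∃ g : L → Z, IsEmbedding g ∧ ∀ x : K, g (e x) = j x

/-- The ball `r • B_{Y*}` of the dual of `Y`, as a set in `Y*` with the weak-star topology. -/
def dualBall (Y : Type u) [NormedAddCommGroup Y] [NormedSpace ℝ Y] (r : ℝ) :
    Set (WeakDual ℝ Y) :=
  {φ | ‖WeakDual.toStrongDual φ‖ ≤ r}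

/-- The remainder `ω* = βω \ ω` of the Čech–Stone compactification of the natural numbers. -/
abbrev OmegaStar : Type := ((Set.range (stoneCechUnit : ℕ → StoneCech ℕ))ᶜ : Set (StoneCech ℕ))

end

noncomputable section

open Topology Filter
open scoped ENNReal

/-! ### Rosenthal's combinatorics: independent subsequences of pairs of sets. -/

section Independence

/-! Restriction of extended sequences to `ω*` identifies `ℓ_∞/c₀` with `C(ω*)`: a sequence is null
iff its extension vanishes on `ω*`, and Tietze gives surjectivity. Hence `f p y = (T y)(p)` matches
contractions `T : Y → ℓ_∞/c₀` with continuous `f : ω* → B_{Y*}`, and `g n y = (S y) n` matches lifts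
`S` with extensions of `f` to `βω`. So (iii) and (iv) hold with the same constant.

Since `ℓ_∞` is injective, each twisted sum of `c₀` and `Y` induces an operator `Y → ℓ_∞/c₀`, and a
lift of it splits the sum; conversely a pullback turns splittings into lifts. The open mapping
theorem makes the lifting constant uniform, so (i) and (iv) agree.

For (ii) ⇒ (iii), glue `βω` to the ball along `f`; realizing the resulting space gives the
extension. For (iii) ⇒ (ii), enumerate `L \ B_{Y*}` and extend the enumeration to `βω → L`; on `ω*`
this is a map into the ball, which extends to `g` on `βω`. The points `g n` may coincide or fall
into the unit ball, so multiples of a weak*-null sequence of large constant norm are added: values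
on `ω*` are unchanged and the points become distinct and leave the ball. Such a sequence exists by
the Josefson–Nissenzweig theorem (`exists_weakStarNull_seq`), the only place where infinite
dimension enters. -/

theorem Set.Infinite.inter_of_diff_finite {α : Type*} {M₁ M₂ P : Set α} (hfin : (M₂ \ M₁).Finite)
    (hP : (M₂ ∩ P).Infinite) : (M₁ ∩ P).Infinite := by
  intro hP'
  refine hP ((hfin.union hP').subset ?_)
  rintro x ⟨hx, hxP⟩
  by_cases hx1 : x ∈ M₁
  · exact Or.inr ⟨hx1, hxP⟩
  · exact Or.inl ⟨hx, hx1⟩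

/-- A fusion argument for properties of infinite sets of natural numbers that pass to almost
contained sets. -/
theorem exists_infinite_subset_forall {Q : ℕ → Set ℕ → Prop}
    (hQ : ∀ n M M', Q n M → (M' \ M).Finite → Q n M') {M₀ : Set ℕ} (h₀ : M₀.Infinite)
    (hstep : ∀ n, ∀ M ⊆ M₀, M.Infinite → ∃ M' ⊆ M, M'.Infinite ∧ Q n M') :
    ∃ M ⊆ M₀, M.Infinite ∧ ∀ n, Q n M := by
  choose! next hsub hinf hnext using hstep
  let F : ℕ → Set ℕ := fun n => Nat.rec M₀ (fun n M => next n M) n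
  have hF : ∀ n, F n ⊆ M₀ ∧ (F n).Infinite := by
    intro n
    induction n with
    | zero => exact ⟨subset_rfl, h₀⟩
    | succ n ih => exact ⟨(hsub n _ ih.1 ih.2).trans ih.1, hinf n _ ih.1 ih.2⟩
  have hanti : Antitone F := antitone_nat_of_succ_le fun n => hsub n _ (hF n).1 (hF n).2
  -- Diagonal set: the term `p k` is taken from `F k`, so `range p` is almost contained in every `F
  -- n`.
  obtain ⟨p, hp, hpF⟩ := extraction_forall_of_frequently (P := fun n k => k ∈ F n)
    fun n => Nat.frequently_atTop_iff_infinite.2 (hF n).2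
  refine ⟨Set.range p, ?_, Set.infinite_range_of_injective hp.injective, fun n => ?_⟩
  · rintro _ ⟨n, rfl⟩
    exact (hF n).1 (hpF n)
  · refine hQ n (F (n + 1)) _ (hnext n _ (hF n).1 (hF n).2) ?_
    refine ((Set.finite_Iio (n + 1)).image p).subset ?_
    rintro _ ⟨⟨k, rfl⟩, hk⟩
    refine ⟨k, ?_, rfl⟩
    by_contra hlt
    exact hk (hanti (not_lt.1 hlt) (hpF k))

variable {S : Type*} {A B : ℕ → Set S}

/-- Along every infinite subset of `M` some point of `T` lies in infinitely many of the sets `A n`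
and in infinitely many of the sets `B n`. -/
def AlternatesOn (A B : ℕ → Set S) (T : Set S) (M : Set ℕ) : Prop :=
  ∀ M' ⊆ M, M'.Infinite → ∃ s ∈ T, (M' ∩ {n | s ∈ A n}).Infinite ∧ (M' ∩ {n | s ∈ B n}).Infinite

/-- If every index `j` failed, each would have a culprit: a set `T` and a side. Fusion makes one
infinite set `D` witness all failures, and pigeonhole fixes the culprit on an infinite part of `D`.
Alternation of that `T` along this part yields a point contradicting the failure. -/
theorem AlternatesOn.exists_split {F : Set (Set S)} (hF : F.Finite) {M : Set ℕ} (hM : M.Infinite)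
    (h : ∀ T ∈ F, AlternatesOn A B T M) (k : ℕ) :
    ∃ j > k, ∃ M' ⊆ M, M'.Infinite ∧
      ∀ T ∈ F, AlternatesOn A B (T ∩ A j) M' ∧ AlternatesOn A B (T ∩ B j) M' := by
  by_contra hcon
  push Not at hcon
  let C : Bool → ℕ → Set S := fun b => bif b then A else B
  let Q : ℕ → Set ℕ → Prop := fun n M' => n > k → ∃ T ∈ F, ∃ b : Bool, ∀ s ∈ T ∩ C b n,
    ¬ ((M' ∩ {n | s ∈ A n}).Infinite ∧ (M' ∩ {n | s ∈ B n}).Infinite)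
  obtain ⟨D, hDM, hD, hQD⟩ := exists_infinite_subset_forall (Q := Q) (by
      intro n M₁ M₂ hn hfin hk
      obtain ⟨T, hT, b, hb⟩ := hn hk
      exact ⟨T, hT, b, fun s hs hs' => hb s hs
        ⟨hs'.1.inter_of_diff_finite hfin, hs'.2.inter_of_diff_finite hfin⟩⟩) hM (by
      intro n M₁ hM₁ hinf
      by_cases hn : n > k
      · obtain ⟨T, hT, hTn⟩ := hcon n hn M₁ hM₁ hinf
        by_cases hA : AlternatesOn A B (T ∩ A n) M₁
        · have hB := hTn hA
          unfold AlternatesOn at hB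
          push Not at hB
          obtain ⟨M₂, h1, h2, h3⟩ := hB
          exact ⟨M₂, h1, h2, fun _ => ⟨T, hT, false, fun s hs hs' =>
            hs'.2 (h3 s hs hs'.1)⟩⟩
        · unfold AlternatesOn at hA
          push Not at hA
          obtain ⟨M₂, h1, h2, h3⟩ := hA
          exact ⟨M₂, h1, h2, fun _ => ⟨T, hT, true, fun s hs hs' =>
            hs'.2 (h3 s hs hs'.1)⟩⟩
      · exact ⟨M₁, subset_rfl, hinf, fun h => absurd h hn⟩)
  have hQ' : ∀ n, ∃ p : Set S × Bool, n > k → p.1 ∈ F ∧ ∀ s ∈ p.1 ∩ C p.2 n,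
      ¬ ((D ∩ {n | s ∈ A n}).Infinite ∧ (D ∩ {n | s ∈ B n}).Infinite) := by
    intro n
    by_cases hn : n > k
    · obtain ⟨T, hT, b, hb⟩ := hQD n hn
      exact ⟨(T, b), fun _ => ⟨hT, hb⟩⟩
    · exact ⟨(∅, true), fun h => absurd h hn⟩
  choose col hcol using hQ'
  have hDk : (D \ Set.Iic k).Infinite := hD.sdiff (Set.finite_Iic k)
  have hmaps : Set.MapsTo col (D \ Set.Iic k) (F ×ˢ (Set.univ : Set Bool)) := by
    rintro n ⟨-, hn⟩
    exact ⟨(hcol n (not_le.1 hn)).1, trivial⟩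
  obtain ⟨p, hp, hpinf⟩ : ∃ p ∈ F ×ˢ (Set.univ : Set Bool),
      ((D \ Set.Iic k) ∩ col ⁻¹' {p}).Infinite := by
    by_contra hfin
    push Not at hfin
    refine hDk (((hF.prod Set.finite_univ).biUnion hfin).subset fun n hn => ?_)
    exact Set.mem_biUnion (hmaps hn) ⟨hn, rfl⟩
  obtain ⟨s, hsT, hsA, hsB⟩ := h p.1 hp.1 _
    (fun n hn => hDM hn.1.1) hpinf
  obtain ⟨n, hn, hsn⟩ : ∃ n ∈ (D \ Set.Iic k) ∩ col ⁻¹' {p}, s ∈ C p.2 n := by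
    rcases hb : p.2 with _ | _
    · obtain ⟨n, hn⟩ := hsB.nonempty
      exact ⟨n, hn.1, hn.2⟩
    · obtain ⟨n, hn⟩ := hsA.nonempty
      exact ⟨n, hn.1, hn.2⟩
  have hpn : col n = p := hn.2
  refine (hcol n (not_le.1 hn.1.2)).2 s (by rw [hpn]; exact ⟨hsT, hsn⟩) ⟨?_, ?_⟩
  · exact hsA.mono fun m hm => ⟨hm.1.1.1, hm.2⟩
  · exact hsB.mono fun m hm => ⟨hm.1.1.1, hm.2⟩

/-- Rosenthal: a sequence of pairs of sets without convergent subsequence has an independent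
subsequence. -/
theorem AlternatesOn.exists_independent {T : Set S} {M : Set ℕ} (hM : M.Infinite)
    (h : AlternatesOn A B T M) :
    ∃ ψ : ℕ → ℕ, ∀ (σ : ℕ → Prop) (N : ℕ), ∃ s ∈ T, ∀ i < N,
      (σ i → s ∈ A (ψ i)) ∧ (¬ σ i → s ∈ B (ψ i)) := by
  -- A state is a finite family containing the cells of all sign patterns so far, with an infinite
  -- set on which all its members alternate. In particular no cell is empty.
  let St := {p : Set (Set S) × Set ℕ // p.1.Finite ∧ p.2.Infinite ∧
    ∀ T ∈ p.1, AlternatesOn A B T p.2}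
  have hstep : ∀ p : St, ∃ q : St × ℕ, ∀ T ∈ p.1.1, T ∩ A q.2 ∈ q.1.1.1 ∧ T ∩ B q.2 ∈ q.1.1.1 := by
    rintro ⟨⟨F, M⟩, hF, hM, hFM⟩
    obtain ⟨j, -, M', -, hM', hj⟩ := AlternatesOn.exists_split hF hM hFM 0
    refine ⟨⟨⟨⟨(fun T => T ∩ A j) '' F ∪ (fun T => T ∩ B j) '' F, M'⟩,
      (hF.image _).union (hF.image _), hM', ?_⟩, j⟩, ?_⟩
    · rintro _ (⟨T, hT, rfl⟩ | ⟨T, hT, rfl⟩)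
      · exact (hj T hT).1
      · exact (hj T hT).2
    · exact fun T hT => ⟨Or.inl ⟨T, hT, rfl⟩, Or.inr ⟨T, hT, rfl⟩⟩
  choose step hstep using hstep
  let p₀ : St := ⟨⟨{T}, M⟩, Set.finite_singleton T, hM, by
    rintro _ rfl
    exact h⟩
  let st : ℕ → St := fun n => Nat.rec p₀ (fun _ p => (step p).1) n
  let ψ : ℕ → ℕ := fun n => (step (st n)).2
  refine ⟨ψ, fun σ N => ?_⟩
  have key : ∀ N, ∃ T' ∈ (st N).1.1, ∀ s ∈ T', s ∈ T ∧ ∀ i < N,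
      (σ i → s ∈ A (ψ i)) ∧ (¬ σ i → s ∈ B (ψ i)) := by
    intro N
    induction N with
    | zero => exact ⟨T, rfl, fun s hs => ⟨hs, fun i hi => absurd hi (Nat.not_lt_zero i)⟩⟩
    | succ N ih =>
      obtain ⟨T', hT', hs⟩ := ih
      by_cases hσ : σ N
      · refine ⟨T' ∩ A (ψ N), (hstep (st N) T' hT').1, fun s hsT => ⟨(hs s hsT.1).1, ?_⟩⟩
        intro i hi
        rcases Nat.lt_succ_iff_lt_or_eq.1 hi with hi | rfl
        · exact (hs s hsT.1).2 i hi
        · exact ⟨fun _ => hsT.2, fun h => absurd hσ h⟩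
      · refine ⟨T' ∩ B (ψ N), (hstep (st N) T' hT').2, fun s hsT => ⟨(hs s hsT.1).1, ?_⟩⟩
        intro i hi
        rcases Nat.lt_succ_iff_lt_or_eq.1 hi with hi | rfl
        · exact (hs s hsT.1).2 i hi
        · exact ⟨fun h => absurd h hσ, fun _ => hsT.2⟩
  obtain ⟨T', hT', hs⟩ := key N
  obtain ⟨s, hsT', -⟩ := (st N).2.2.2 T' hT' _ subset_rfl (st N).2.2.1
  exact ⟨s, hs s hsT'⟩

end Independence

/-! ### The Josefson–Nissenzweig theorem. -/

section JosefsonNissenzweig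

variable {X : Type*} [NormedAddCommGroup X] [NormedSpace ℝ X]

/-- The sequence of functionals realizes every finite sign pattern, with values at least `c` in
absolute value, on the unit ball. -/
def IsSignIndependent (c : ℝ) (v : ℕ → StrongDual ℝ X) : Prop :=
  ∀ (σ : ℕ → Prop) (N : ℕ), ∃ x : X, ‖x‖ ≤ 1 ∧ ∀ i < N,
    (σ i → c ≤ v i x) ∧ (¬ σ i → v i x ≤ -c)

/-- Halved differences of consecutive disjoint pairs. -/
def halfDiff (v : ℕ → StrongDual ℝ X) (k : ℕ) : StrongDual ℝ X :=
  (1 / 2 : ℝ) • (v (2 * k) - v (2 * k + 1))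

theorem halfDiff_apply (v : ℕ → StrongDual ℝ X) (k : ℕ) (x : X) :
    halfDiff v k x = (v (2 * k) x - v (2 * k + 1) x) / 2 := by
  simp [halfDiff]; ring

theorem norm_halfDiff_le {v : ℕ → StrongDual ℝ X} {R : ℝ} (hv : ∀ k, ‖v k‖ ≤ R) (k : ℕ) :
    ‖halfDiff v k‖ ≤ R := by
  have h := norm_sub_le (v (2 * k)) (v (2 * k + 1))
  have h1 := hv (2 * k)
  have h2 := hv (2 * k + 1)
  rw [halfDiff, norm_smul]
  norm_num
  linarith

namespace IsSignIndependent

variable {c : ℝ} {v : ℕ → StrongDual ℝ X}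

theorem comp (h : IsSignIndependent c v) {φ : ℕ → ℕ} (hφ : StrictMono φ) :
    IsSignIndependent c (v ∘ φ) := by
  intro σ N
  obtain ⟨x, hx, hxv⟩ := h (fun j => ∃ i, φ i = j ∧ σ i) (φ N)
  refine ⟨x, hx, fun i hi => ?_⟩
  have hiff : (∃ i', φ i' = φ i ∧ σ i') ↔ σ i :=
    ⟨fun ⟨i', h1, h2⟩ => hφ.injective h1 ▸ h2, fun h => ⟨i, rfl, h⟩⟩
  have := hxv (φ i) (hφ hi)
  rwa [hiff] at this

theorem halfDiff (h : IsSignIndependent c v) : IsSignIndependent c (halfDiff v) := by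
  intro σ N
  -- The pattern puts the sign of `σ i` at `2 * i` and the opposite sign at `2 * i + 1`, so the two
  -- terms reinforce each other in the difference.
  obtain ⟨x, hx, hxv⟩ := h (fun j => Even j ↔ σ (j / 2)) (2 * N)
  refine ⟨x, hx, fun i hi => ?_⟩
  have h1 := hxv (2 * i) (by omega)
  have h2 := hxv (2 * i + 1) (by omega)
  have e1 : 2 * i / 2 = i := by omega
  have e2 : (2 * i + 1) / 2 = i := by omega
  have o : ¬ Even (2 * i + 1) := by simp
  have e : Even (2 * i) := by simp
  simp only [e1, e2, o, e, true_iff, false_iff, not_not] at h1 h2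
  rw [halfDiff_apply]
  constructor
  · intro hσ
    have := h1.1 hσ
    have := h2.2 hσ
    linarith
  · intro hσ
    have := h1.2 hσ
    have := h2.1 hσ
    linarith

theorem le_norm (h : IsSignIndependent c v) (k : ℕ) : c ≤ ‖v k‖ := by
  obtain ⟨x, hx, hxv⟩ := h (fun _ => True) (k + 1)
  calc c ≤ v k x := (hxv k (by omega)).1 trivial
    _ ≤ ‖v k x‖ := le_abs_self _
    _ ≤ ‖v k‖ * ‖x‖ := (v k).le_opNorm x
    _ ≤ ‖v k‖ * 1 := by gcongr
    _ = ‖v k‖ := mul_one _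

end IsSignIndependent

/-- Almost all `w k` are in the bipolar of every tail of `v`. -/
def IsDominatedBy (w v : ℕ → StrongDual ℝ X) : Prop :=
  ∀ m, ∀ᶠ k in atTop, ∀ (x : X) (t : ℝ), (∀ i ≥ m, |v i x| ≤ t) → |w k x| ≤ t

namespace IsDominatedBy

variable {u v w : ℕ → StrongDual ℝ X}

theorem refl (v : ℕ → StrongDual ℝ X) : IsDominatedBy v v := fun m => by
  filter_upwards [eventually_ge_atTop m] with k hk x t h using h k hk

theorem trans (h₁ : IsDominatedBy w v) (h₂ : IsDominatedBy v u) : IsDominatedBy w u := by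
  intro m
  obtain ⟨m', hm'⟩ := eventually_atTop.1 (h₂ m)
  filter_upwards [h₁ m'] with k hk x t h
  exact hk x t fun i hi => hm' i hi x t h

theorem comp (v : ℕ → StrongDual ℝ X) {φ : ℕ → ℕ} (hφ : StrictMono φ) :
    IsDominatedBy (v ∘ φ) v := fun m => by
  filter_upwards [hφ.tendsto_atTop.eventually_ge_atTop m] with k hk x t h using h _ hk

theorem halfDiff (v : ℕ → StrongDual ℝ X) : IsDominatedBy (halfDiff v) v := fun m => by
  filter_upwards [eventually_ge_atTop m] with k hk x t h
  have h1 := abs_le.1 (h (2 * k) (by omega))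
  have h2 := abs_le.1 (h (2 * k + 1) (by omega))
  rw [halfDiff_apply, abs_le]
  constructor <;> linarith

end IsDominatedBy

theorem tendsto_zero_of_forall_norm_le_one {w : ℕ → StrongDual ℝ X}
    (h : ∀ x : X, ‖x‖ ≤ 1 → Tendsto (fun k => w k x) atTop (𝓝 0)) (x : X) :
    Tendsto (fun k => w k x) atTop (𝓝 0) := by
  have h1 : ‖(‖x‖ + 1)⁻¹ • x‖ ≤ 1 := by
    rw [norm_smul, norm_inv, Real.norm_of_nonneg (by positivity), inv_mul_le_one₀ (by positivity)]
    linarith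
  have h2 := (h _ h1).const_mul (‖x‖ + 1)
  simp only [map_smul, smul_eq_mul, mul_zero] at h2
  refine h2.congr fun k => ?_
  field_simp

/-- If no `v` and `δ` work, one can pass repeatedly to dominated independent sequences whose upper
limits on the unit ball are at most `1 / (n + 1)`. A diagonal choice is then weak*-null, and
independence keeps its norms at least `c`. -/
theorem exists_weakStarNull_or_uniform {c R : ℝ} {v₀ : ℕ → StrongDual ℝ X}
    (h₀ : IsSignIndependent c v₀) (hR : ∀ k, ‖v₀ k‖ ≤ R) :
    (∃ w : ℕ → StrongDual ℝ X, (∀ k, c ≤ ‖w k‖) ∧ (∀ k, ‖w k‖ ≤ R) ∧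
      ∀ x, Tendsto (fun k => w k x) atTop (𝓝 0)) ∨
    ∃ (v : ℕ → StrongDual ℝ X) (δ : ℝ), 0 < δ ∧ IsSignIndependent c v ∧ (∀ k, ‖v k‖ ≤ R) ∧
      ∀ w, IsSignIndependent c w → IsDominatedBy w v →
        ∃ x : X, ‖x‖ ≤ 1 ∧ ∃ᶠ k in atTop, δ < |w k x| := by
  by_contra hcon
  rw [not_or] at hcon
  obtain ⟨hnull, hunif⟩ := hcon
  push Not at hunif
  let St := {v : ℕ → StrongDual ℝ X // IsSignIndependent c v ∧ ∀ k, ‖v k‖ ≤ R}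
  have hstep : ∀ (n : ℕ) (v : St), ∃ w : St, IsDominatedBy w.1 v.1 ∧
      ∀ x : X, ‖x‖ ≤ 1 → ∀ᶠ k in atTop, |w.1 k x| ≤ 1 / ((n : ℝ) + 1) := by
    rintro n ⟨v, hv, hvR⟩
    obtain ⟨w, hw, hwv, hwx⟩ := hunif v _ (Nat.one_div_pos_of_nat (n := n)) hv hvR
    obtain ⟨K, hK⟩ := eventually_atTop.1 (hwv 0)
    -- Beyond `K` the terms lie in the bipolar of `v`, so dropping the others restores the norm
    -- bound `R`.
    have hmono : StrictMono fun k => k + K := fun _ _ h => Nat.add_lt_add_right h K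
    refine ⟨⟨w ∘ fun k => k + K, hw.comp hmono, fun k => ?_⟩,
      (IsDominatedBy.comp w hmono).trans hwv, fun x hx => ?_⟩
    · refine ContinuousLinearMap.opNorm_le_bound _ ((norm_nonneg _).trans (hvR 0)) fun x => ?_
      exact hK (k + K) (by omega) x _ fun i _ => (v i).le_of_opNorm_le (hvR i) x
    · exact hmono.tendsto_atTop.eventually (hwx x hx)
  choose step hdom hsmall using hstep
  let V : ℕ → St := fun n => Nat.rec ⟨v₀, h₀, hR⟩ (fun n v => step n v) n
  have hV : ∀ n m, n ≤ m → IsDominatedBy (V m).1 (V n).1 := by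
    intro n m hnm
    induction m, hnm using Nat.le_induction with
    | base => exact IsDominatedBy.refl _
    | succ m _ ih => exact (hdom m (V m)).trans ih
  -- The diagonal term from `V j` is dominated by the tail from `j` of every earlier `V n` at once,
  -- so it inherits all their smallness bounds.
  have hex : ∀ j, ∃ i, ∀ n ≤ j, ∀ (x : X) (t : ℝ), (∀ l ≥ j, |(V n).1 l x| ≤ t) →
      |(V j).1 i x| ≤ t := by
    intro j
    have : ∀ᶠ i in atTop, ∀ n ∈ Set.Iic j, ∀ (x : X) (t : ℝ), (∀ l ≥ j, |(V n).1 l x| ≤ t) →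
        |(V j).1 i x| ≤ t :=
      (Filter.eventually_all_finite (Set.finite_Iic j)).2 fun n hn => hV n j hn j
    exact this.exists
  choose i hi using hex
  refine hnull ⟨fun j => (V j).1 (i j), fun j => (V j).2.1.le_norm _, fun j => (V j).2.2 _, ?_⟩
  refine tendsto_zero_of_forall_norm_le_one fun x hx => ?_
  rw [Metric.tendsto_atTop]
  intro ε hε
  obtain ⟨n, hn⟩ := exists_nat_one_div_lt hε
  obtain ⟨l, hl⟩ := eventually_atTop.1 (hsmall n (V n) x hx)
  refine ⟨max l (n + 1), fun j hj => ?_⟩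
  rw [Real.dist_eq, sub_zero]
  refine lt_of_le_of_lt (hi j (n + 1) (le_of_max_le_right hj) x _ fun k hk => ?_) hn
  exact hl k (by have := le_of_max_le_left hj; omega)

/-- Repeatedly pass to a subsequence that is at least `δ` at a point of the unit ball, then take
half differences. The matching half sums, averaged down the dyadic tree, satisfy a Bessel inequality
by the parallelogram identity. Weak* limits `l n` then satisfy `∑ (l n x)² ≤ ‖x‖²`, which forces `l
n x → 0`, while `l n` remains at least `δ` at its point. -/
theorem exists_weakStarNull_of_uniform {c δ : ℝ} {v : ℕ → StrongDual ℝ X}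
    (hv : IsSignIndependent c v) (hv1 : ∀ k, ‖v k‖ ≤ 1)
    (hunif : ∀ w, IsSignIndependent c w → IsDominatedBy w v →
      ∃ x : X, ‖x‖ ≤ 1 ∧ ∃ᶠ k in atTop, δ < |w k x|) :
    ∃ y : ℕ → StrongDual ℝ X, (∀ k, δ ≤ ‖y k‖) ∧ (∀ k, ‖y k‖ ≤ 1) ∧
      ∀ x, Tendsto (fun k => y k x) atTop (𝓝 0) := by
  have hstep : ∀ w : {w : ℕ → StrongDual ℝ X // IsSignIndependent c w ∧ IsDominatedBy w v},
      ∃ (x : X) (φ : ℕ → ℕ), ‖x‖ ≤ 1 ∧ StrictMono φ ∧ ∀ k, δ ≤ w.1 (φ k) x := by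
    rintro ⟨w, hw, hwv⟩
    obtain ⟨x, hx, hxw⟩ := hunif w hw hwv
    have : ∃ᶠ k in atTop, δ < w k x ∨ δ < w k (-x) := by
      refine hxw.mono fun k hk => ?_
      rw [map_neg]
      exact lt_abs.1 hk
    rcases frequently_or_distrib.1 this with h | h
    · obtain ⟨φ, hφ, hφx⟩ := extraction_of_frequently_atTop h
      exact ⟨x, φ, hx, hφ, fun k => (hφx k).le⟩
    · obtain ⟨φ, hφ, hφx⟩ := extraction_of_frequently_atTop h
      exact ⟨-x, φ, by rwa [norm_neg], hφ, fun k => (hφx k).le⟩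
  choose pt φ hpt hφ hptφ using hstep
  let W : ℕ → {w : ℕ → StrongDual ℝ X // IsSignIndependent c w ∧ IsDominatedBy w v} := fun n =>
    Nat.rec ⟨v, hv, IsDominatedBy.refl v⟩ (fun _ w => ⟨halfDiff (w.1 ∘ φ w),
      (w.2.1.comp (hφ w)).halfDiff,
      ((IsDominatedBy.halfDiff _).trans (IsDominatedBy.comp _ (hφ w))).trans w.2.2⟩) n
  have key : ∀ N k, ∃ y : ℕ → StrongDual ℝ X, (∀ n < N, δ ≤ y n (pt (W n))) ∧
      ∀ x, ∑ n ∈ Finset.range N, (y n x) ^ 2 + ((W N).1 k x) ^ 2 ≤ ‖x‖ ^ 2 := by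
    intro N
    induction N with
    | zero =>
      refine fun k => ⟨0, by simp, fun x => ?_⟩
      have h1 : ‖v k x‖ ≤ ‖x‖ := by
        simpa using (v k).le_of_opNorm_le (hv1 k) x
      have h2 : (v k x) ^ 2 ≤ ‖x‖ ^ 2 := by
        rw [← sq_abs]
        gcongr
        exact h1
      rw [Finset.range_zero, Finset.sum_empty, zero_add]
      exact h2
    | succ N ih =>
      intro k
      obtain ⟨y₁, hy₁, hs₁⟩ := ih (φ (W N) (2 * k))
      obtain ⟨y₂, hy₂, hs₂⟩ := ih (φ (W N) (2 * k + 1))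
      set p := (W N).1 (φ (W N) (2 * k)) with hp
      set q := (W N).1 (φ (W N) (2 * k + 1)) with hq
      have hW : ∀ x, (W (N + 1)).1 k x = (p x - q x) / 2 := fun x => halfDiff_apply _ k x
      -- Old coordinates are averaged, which does not raise the mean square; the new one is the half
      -- sum of the pair whose half difference is `W (N + 1)` at `k`.
      refine ⟨fun n => if n < N then (1 / 2 : ℝ) • (y₁ n + y₂ n) else (1 / 2 : ℝ) • (p + q), ?_, ?_⟩
      · intro n hn
        by_cases hnN : n < N
        · have h1 := hy₁ n hnN
          have h2 := hy₂ n hnN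
          simp only [hnN, if_true, smul_apply, add_apply,
            smul_eq_mul]
          linarith
        · obtain rfl : n = N := by omega
          have h1 : δ ≤ p (pt (W n)) := hptφ (W n) (2 * k)
          have h2 : δ ≤ q (pt (W n)) := hptφ (W n) (2 * k + 1)
          simp only [lt_irrefl, if_false, smul_apply,
            add_apply, smul_eq_mul]
          linarith
      · intro x
        have hsum : ∑ n ∈ Finset.range N,
            ((if n < N then (1 / 2 : ℝ) • (y₁ n + y₂ n) else (1 / 2 : ℝ) • (p + q)) x) ^ 2 ≤
            (∑ n ∈ Finset.range N, (y₁ n x) ^ 2 + ∑ n ∈ Finset.range N, (y₂ n x) ^ 2) / 2 := by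
          rw [← Finset.sum_add_distrib, Finset.sum_div]
          refine Finset.sum_le_sum fun n hn => ?_
          simp only [Finset.mem_range.1 hn, if_true, smul_apply,
            add_apply, smul_eq_mul]
          nlinarith [sq_nonneg (y₁ n x - y₂ n x)]
        rw [Finset.sum_range_succ, hW]
        simp only [lt_irrefl, if_false, smul_apply,
            add_apply, smul_eq_mul]
        have h1 := hs₁ x
        have h2 := hs₂ x
        nlinarith [hsum]
  choose y hy hsum using fun N => key N 0
  have hsq : ∀ N m, m ≤ N → ∀ x, ∑ n ∈ Finset.range m, (y N n x) ^ 2 ≤ ‖x‖ ^ 2 := by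
    intro N m hm x
    have h1 := hsum N x
    have h2 : ∑ n ∈ Finset.range m, (y N n x) ^ 2 ≤ ∑ n ∈ Finset.range N, (y N n x) ^ 2 :=
      Finset.sum_le_sum_of_subset_of_nonneg (Finset.range_mono hm) fun _ _ _ => sq_nonneg _
    nlinarith [sq_nonneg ((W N).1 0 x)]
  have hnorm : ∀ N n, n < N → ‖y N n‖ ≤ 1 := by
    intro N n hn
    refine ContinuousLinearMap.opNorm_le_bound _ zero_le_one fun x => ?_
    have h1 := hsq N (n + 1) hn x
    rw [Finset.sum_range_succ] at h1
    have h2 : 0 ≤ ∑ n ∈ Finset.range n, (y N n x) ^ 2 := Finset.sum_nonneg fun _ _ => sq_nonneg _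
    rw [one_mul]
    exact abs_le_of_sq_le_sq (by linarith) (norm_nonneg x)
  -- The value `0` is padding, irrelevant in the limit. The limit is along an ultrafilter, since the
  -- dual ball need not be weak* sequentially compact.
  let z : ℕ → ℕ → WeakDual ℝ X := fun N n => StrongDual.toWeakDual (if n < N then y N n else 0)
  have hcpt : IsCompact (Set.univ.pi fun _ : ℕ =>
      (WeakDual.toStrongDual ⁻¹' Metric.closedBall (0 : StrongDual ℝ X) 1)) :=
    isCompact_univ_pi fun _ => WeakDual.isCompact_closedBall 0 1
  obtain ⟨l, hl, hlim⟩ := hcpt.ultrafilter_le_nhds ((hyperfilter ℕ).map z) (by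
    rw [le_principal_iff]
    refine Filter.mem_map.2 (Filter.univ_mem' fun N => ?_)
    rintro n -
    by_cases hn : n < N
    · simpa [z, hn] using hnorm N n hn
    · simp [z, hn])
  have htend : ∀ n x, Tendsto (fun N => z N n x) (hyperfilter ℕ) (𝓝 (l n x)) := by
    intro n x
    have h1 : Tendsto z (hyperfilter ℕ) (𝓝 l) := hlim
    exact ((WeakDual.eval_continuous x).tendsto _).comp ((tendsto_pi_nhds.1 h1) n)
  have hev : ∀ n, ∀ᶠ N in (hyperfilter ℕ : Filter ℕ), n < N := fun n =>
    (Nat.hyperfilter_le_atTop : (hyperfilter ℕ : Filter ℕ) ≤ atTop) (eventually_gt_atTop n)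
  have hz : ∀ n x, ∀ᶠ N in (hyperfilter ℕ : Filter ℕ), z N n x = y N n x := by
    intro n x
    filter_upwards [hev n] with N hN
    simp only [z, hN, if_true]
    rfl
  have hlsq : ∀ m x, ∑ n ∈ Finset.range m, (l n x) ^ 2 ≤ ‖x‖ ^ 2 := by
    intro m x
    refine le_of_tendsto (tendsto_finsetSum _ fun n _ => (htend n x).pow 2) ?_
    filter_upwards [hev m, (Filter.eventually_all_finset (Finset.range m)).2 fun n _ => hz n x]
      with N hN hzN
    rw [Finset.sum_congr rfl fun n hn => by rw [hzN n hn]]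
    exact hsq N m hN.le x
  refine ⟨fun n => WeakDual.toStrongDual (l n), fun n => ?_, fun n => ?_, fun x => ?_⟩
  · have h1 : δ ≤ l n (pt (W n)) := by
      refine ge_of_tendsto (htend n (pt (W n))) ?_
      filter_upwards [hev n, hz n (pt (W n))] with N hN hzN
      rw [hzN]
      exact hy N n hN
    calc δ ≤ ‖WeakDual.toStrongDual (l n) (pt (W n))‖ := h1.trans (le_abs_self _)
      _ ≤ ‖WeakDual.toStrongDual (l n)‖ * ‖pt (W n)‖ := ContinuousLinearMap.le_opNorm _ _
      _ ≤ ‖WeakDual.toStrongDual (l n)‖ * 1 := by gcongr; exact hpt _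
      _ = _ := mul_one _
  · simpa using hl n trivial
  · have hs : Summable fun n => (l n x) ^ 2 :=
      summable_of_sum_range_le (fun _ => sq_nonneg _) (fun m => hlsq m x)
    have h0 := hs.tendsto_atTop_zero
    have := h0.sqrt
    simp only [Real.sqrt_sq_eq_abs, Real.sqrt_zero] at this
    exact (tendsto_zero_iff_abs_tendsto_zero _).2 this

/-- If no pair of levels `a < b` alternated, fusion over rational pairs would give a subsequence
without infinitely many crossings at any point, hence pointwise convergent. The constant is `(b - a)
/ 2`, from half differences of values above `b` and below `a`. -/
theorem exists_isSignIndependent {u : ℕ → StrongDual ℝ X} {R : ℝ} (hR : ∀ k, ‖u k‖ ≤ R)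
    (hu : ∀ φ : ℕ → ℕ, StrictMono φ →
      ∃ x : X, ‖x‖ ≤ 1 ∧ ¬ ∃ l, Tendsto (fun k => u (φ k) x) atTop (𝓝 l)) :
    ∃ (v : ℕ → StrongDual ℝ X) (c : ℝ), 0 < c ∧ IsSignIndependent c v ∧ ∀ k, ‖v k‖ ≤ R := by
  obtain ⟨a, b, hab, M, hM, halt⟩ : ∃ a b : ℝ, a < b ∧ ∃ M : Set ℕ, M.Infinite ∧
      AlternatesOn (fun n => {x : X | b < u n x}) (fun n => {x : X | u n x < a})
        {x | ‖x‖ ≤ 1} M := by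
    by_contra hcon
    push Not at hcon
    obtain ⟨f, hf⟩ := exists_surjective_nat (ℚ × ℚ)
    let Q : ℕ → Set ℕ → Prop := fun n M => ((f n).1 : ℝ) < (f n).2 → ∀ x : X, ‖x‖ ≤ 1 →
      ¬ ((M ∩ {k | ((f n).2 : ℝ) < u k x}).Infinite ∧ (M ∩ {k | u k x < (f n).1}).Infinite)
    obtain ⟨M, -, hM, hQM⟩ := exists_infinite_subset_forall (Q := Q) (M₀ := Set.univ)
      (fun n M₁ M₂ hn hfin hlt x hx hx' => hn hlt x hx
        ⟨hx'.1.inter_of_diff_finite hfin, hx'.2.inter_of_diff_finite hfin⟩) Set.infinite_univ (by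
      intro n M₁ _ hinf
      by_cases hlt : ((f n).1 : ℝ) < (f n).2
      · have := hcon _ _ hlt M₁ hinf
        unfold AlternatesOn at this
        push Not at this
        obtain ⟨M₂, h1, h2, h3⟩ := this
        exact ⟨M₂, h1, h2, fun _ x hx hx' => hx'.2 (h3 x hx hx'.1)⟩
      · exact ⟨M₁, subset_rfl, hinf, fun h => absurd h hlt⟩)
    obtain ⟨φ, hφ, hφM⟩ := extraction_of_frequently_atTop
      (Nat.frequently_atTop_iff_infinite.2 hM : ∃ᶠ n in atTop, n ∈ M)
    obtain ⟨x, hx, hnot⟩ := hu φ hφ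
    have hbd : ∀ k, |u (φ k) x| ≤ R := fun k =>
      calc ‖u (φ k) x‖ ≤ ‖u (φ k)‖ * ‖x‖ := ContinuousLinearMap.le_opNorm _ _
        _ ≤ R * 1 := by
          gcongr
          · exact (norm_nonneg _).trans (hR 0)
          · exact hR _
        _ = R := mul_one R
    refine hnot (tendsto_of_no_upcrossings (s := Set.range ((↑) : ℚ → ℝ)) Rat.denseRange_cast ?_
      (isBoundedUnder_of ⟨R, fun k => (abs_le.1 (hbd k)).2⟩)
      (isBoundedUnder_of ⟨-R, fun k => (abs_le.1 (hbd k)).1⟩))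
    rintro _ ⟨a, rfl⟩ _ ⟨b, rfl⟩ hab ⟨h1, h2⟩
    obtain ⟨n, hn⟩ := hf (a, b)
    have hQ := hQM n
    simp only [Q, hn] at hQ
    have him : ∀ P : ℕ → Prop, (∃ᶠ k in atTop, P (φ k)) → (M ∩ {k | P k}).Infinite := by
      intro P hP
      refine ((Nat.frequently_atTop_iff_infinite.1 hP).image hφ.injective.injOn).mono ?_
      rintro _ ⟨k, hk, rfl⟩
      exact ⟨hφM k, hk⟩
    exact hQ hab x hx ⟨him _ h2, him _ h1⟩
  obtain ⟨ψ, hψ⟩ := halt.exists_independent hM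
  refine ⟨halfDiff (u ∘ ψ), (b - a) / 2, by linarith, ?_, norm_halfDiff_le fun k => hR _⟩
  intro σ N
  obtain ⟨x, hx, hxv⟩ := hψ (fun j => Even j ↔ σ (j / 2)) (2 * N)
  refine ⟨x, hx, fun i hi => ?_⟩
  have h1 := hxv (2 * i) (by omega)
  have h2 := hxv (2 * i + 1) (by omega)
  have e1 : 2 * i / 2 = i := by omega
  have e2 : (2 * i + 1) / 2 = i := by omega
  have o : ¬ Even (2 * i + 1) := by simp
  have e : Even (2 * i) := by simp
  simp only [e1, e2, o, e, true_iff, false_iff, not_not] at h1 h2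
  rw [halfDiff_apply]
  simp only [Function.comp]
  constructor
  · intro hσ
    have : b < _ := h1.1 hσ
    have : _ < a := h2.2 hσ
    linarith
  · intro hσ
    have : _ < a := h1.2 hσ
    have : b < _ := h2.1 hσ
    linarith

theorem not_finiteDimensional_strongDual (hX : ¬ FiniteDimensional ℝ X) :
    ¬ FiniteDimensional ℝ (StrongDual ℝ X) := by
  intro h
  have : FiniteDimensional ℝ (StrongDual ℝ (StrongDual ℝ X)) := inferInstance
  exact hX (FiniteDimensional.of_injective
    (NormedSpace.inclusionInDoubleDual ℝ X).toLinearMap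
    (NormedSpace.inclusionInDoubleDualLi ℝ (E := X)).injective)

/-- The **Josefson–Nissenzweig theorem** for real normed spaces. -/
theorem exists_weakStarNull_seq (hX : ¬ FiniteDimensional ℝ X) :
    ∃ (y : ℕ → StrongDual ℝ X) (c : ℝ), 0 < c ∧ (∀ k, c ≤ ‖y k‖) ∧
      ∀ x, Tendsto (fun k => y k x) atTop (𝓝 0) := by
  obtain ⟨R, u, hR1, hR, hu⟩ :=
    exists_seq_norm_le_one_le_norm_sub (not_finiteDimensional_strongDual hX)
  by_cases hconv : ∃ φ : ℕ → ℕ, StrictMono φ ∧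
      ∀ x : X, ‖x‖ ≤ 1 → ∃ l, Tendsto (fun k => u (φ k) x) atTop (𝓝 l)
  · obtain ⟨φ, hφ, hlim⟩ := hconv
    -- The bound `1` is the separation of the Riesz sequence `u`.
    refine ⟨fun k => u (φ (k + 1)) - u (φ k), 1, one_pos, fun k => hu ?_,
      tendsto_zero_of_forall_norm_le_one fun x hx => ?_⟩
    · exact (hφ (Nat.lt_succ_self k)).ne'
    · obtain ⟨l, hl⟩ := hlim x hx
      simpa using (hl.comp (tendsto_add_atTop_nat 1)).sub hl
  · push Not at hconv
    have hRpos : 0 < R := by linarith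
    have hsc : ∀ k, ‖R⁻¹ • u k‖ ≤ 1 := fun k => by
      rw [norm_smul, norm_inv, Real.norm_of_nonneg hRpos.le, inv_mul_le_one₀ hRpos]
      exact hR k
    obtain ⟨v, c, hc, hv, hv1⟩ := exists_isSignIndependent (u := fun k => R⁻¹ • u k) hsc (by
      intro φ hφ
      obtain ⟨x, hx, hnot⟩ := hconv φ hφ
      refine ⟨x, hx, fun ⟨l, hl⟩ => hnot (R * l) ?_⟩
      refine (hl.const_mul R).congr fun k => ?_
      simp only [smul_apply, smul_eq_mul]
      field_simp)
    rcases exists_weakStarNull_or_uniform hv hv1 with ⟨w, h1, -, h3⟩ | ⟨w, δ, hδ, hw, hw1, hunif⟩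
    · exact ⟨w, c, hc, h1, h3⟩
    · obtain ⟨y, h1, -, h3⟩ := exists_weakStarNull_of_uniform hw hw1 hunif
      exact ⟨y, δ, hδ, h1, h3⟩

end JosefsonNissenzweig

/-! ### `ℓ_∞/c₀` as functions on `ω*`. -/

section BetaOmega

theorem stoneCechUnit_nat_injective :
    Function.Injective (stoneCechUnit : ℕ → StoneCech ℕ) := by
  intro m n h
  by_contra hmn
  have := eq_if_stoneCechUnit_eq (f := fun k : ℕ => decide (k = m))
    continuous_of_discreteTopology h
  simp [Ne.symm hmn] at this

/-- An open subset of `βω` with finite trace on `ω` is contained in `ω`. -/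
theorem subset_range_stoneCechUnit_image {U : Set (StoneCech ℕ)} (hU : IsOpen U)
    (hfin : (stoneCechUnit ⁻¹' U : Set ℕ).Finite) : U ⊆ stoneCechUnit '' (stoneCechUnit ⁻¹' U) := by
  have h := (denseRange_stoneCechUnit (α := ℕ)).open_subset_closure_inter hU
  rwa [← Set.image_preimage_eq_inter_range, (hfin.image _).isClosed.closure_eq] at h

theorem isOpen_singleton_stoneCechUnit (n : ℕ) :
    IsOpen ({stoneCechUnit n} : Set (StoneCech ℕ)) := by
  have hc : Continuous fun k : ℕ => decide (k = n) := continuous_of_discreteTopology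
  let U : Set (StoneCech ℕ) := stoneCechExtend hc ⁻¹' {true}
  have hU : IsOpen U := (isOpen_discrete _).preimage (continuous_stoneCechExtend hc)
  have hpre : (stoneCechUnit ⁻¹' U : Set ℕ) = {n} := by
    ext k
    simp [U]
  have hsub := subset_range_stoneCechUnit_image hU (by rw [hpre]; exact Set.finite_singleton n)
  rw [hpre, Set.image_singleton] at hsub
  have : U = {stoneCechUnit n} := by
    refine hsub.antisymm ?_
    rintro _ rfl
    have : n ∈ (stoneCechUnit ⁻¹' U : Set ℕ) := by rw [hpre]; rfl
    exact this
  rwa [← this]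

theorem isClosed_omegaStar :
    IsClosed ((Set.range (stoneCechUnit : ℕ → StoneCech ℕ))ᶜ : Set (StoneCech ℕ)) := by
  rw [isClosed_compl_iff, ← Set.iUnion_singleton_eq_range]
  exact isOpen_iUnion isOpen_singleton_stoneCechUnit

/-- If `h` vanishes on `ω*`, the compact set `{ε ≤ |h|}` is covered by isolated points, so it is
finite. Conversely, an open set with finite trace on `ω` misses `ω*`. -/
theorem forall_omegaStar_eq_zero_iff (h : C(StoneCech ℕ, ℝ)) :
    (∀ p : OmegaStar, h p = 0) ↔ Tendsto (fun n => h (stoneCechUnit n)) atTop (𝓝 0) := by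
  rw [← Nat.cofinite_eq_atTop, Metric.tendsto_nhds]
  constructor
  · intro h0 ε hε
    have hclosed : IsClosed {p | ε ≤ |h p|} := isClosed_le continuous_const h.continuous.abs
    obtain ⟨t, ht⟩ := hclosed.isCompact.elim_finite_subcover
      (fun n : ℕ => ({stoneCechUnit n} : Set (StoneCech ℕ))) isOpen_singleton_stoneCechUnit (by
        intro p hp
        by_contra hnot
        have : p ∈ (Set.range (stoneCechUnit : ℕ → StoneCech ℕ))ᶜ := by
          rintro ⟨n, rfl⟩
          exact hnot (Set.mem_iUnion.2 ⟨n, rfl⟩)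
        have hz := h0 ⟨p, this⟩
        simp only [Set.mem_ofPred_eq] at hp
        simp only at hz
        rw [hz, abs_zero] at hp
        exact absurd hp (not_le.2 hε))
    rw [Filter.eventually_cofinite]
    refine t.finite_toSet.subset fun n hn => ?_
    have hn' : ε ≤ |h (stoneCechUnit n)| := by simpa using hn
    obtain ⟨m, hm, hmn⟩ := Set.mem_iUnion₂.1 (ht hn')
    exact stoneCechUnit_nat_injective hmn ▸ hm
  · rintro h0 ⟨p, hp⟩
    by_contra hne
    have hpos : 0 < |h p| / 2 := by
      have : 0 < |h p| := abs_pos.2 hne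
      positivity
    have hU : IsOpen {q | |h p| / 2 < |h q|} := isOpen_lt continuous_const h.continuous.abs
    have hfin : (stoneCechUnit ⁻¹' {q | |h p| / 2 < |h q|} : Set ℕ).Finite := by
      refine (Filter.eventually_cofinite.1 (h0 _ hpos)).subset fun n hn => ?_
      have hn' : |h p| / 2 < |h (stoneCechUnit n)| := hn
      simpa using hn'.le
    obtain ⟨n, -, hn⟩ := subset_range_stoneCechUnit_image hU hfin
      (show |h p| / 2 < |h p| by linarith)
    exact hp ⟨n, hn⟩

theorem exists_continuous_extension (x : EllInfty) :
    ∃ h : C(StoneCech ℕ, ℝ), ∀ n, h (stoneCechUnit n) = x n := by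
  have hx : ∀ n, x n ∈ Metric.closedBall (0 : ℝ) ‖x‖ := fun n => by
    simpa using lp.norm_apply_le_norm ENNReal.top_ne_zero x n
  have hc : Continuous fun n => (⟨x n, hx n⟩ : Metric.closedBall (0 : ℝ) ‖x‖) :=
    continuous_of_discreteTopology
  have : CompactSpace (Metric.closedBall (0 : ℝ) ‖x‖) :=
    isCompact_iff_compactSpace.1 (isCompact_closedBall _ _)
  exact ⟨⟨fun p => (stoneCechExtend hc p : Metric.closedBall (0 : ℝ) ‖x‖),
    continuous_subtype_val.comp (continuous_stoneCechExtend hc)⟩, fun n => by simp⟩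

/-- The continuous extension to `βω` of a bounded sequence. -/
def betaExtend (x : EllInfty) : C(StoneCech ℕ, ℝ) := (exists_continuous_extension x).choose

@[simp]
theorem betaExtend_stoneCechUnit (x : EllInfty) (n : ℕ) :
    betaExtend x (stoneCechUnit n) = x n := (exists_continuous_extension x).choose_spec n

theorem eq_of_eq_stoneCechUnit {Z : Type*} [TopologicalSpace Z] [T2Space Z] {g h : StoneCech ℕ → Z}
    (hg : Continuous g) (hh : Continuous h) (H : ∀ n : ℕ, g (stoneCechUnit n) = h (stoneCechUnit n))
    (p : StoneCech ℕ) : g p = h p :=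
  congrFun (denseRange_stoneCechUnit.equalizer hg hh (funext H)) p

/-- The evaluation at a point of `βω`, as a linear functional on bounded sequences. -/
def betaLim (p : StoneCech ℕ) : EllInfty →ₗ[ℝ] ℝ where
  toFun x := betaExtend x p
  map_add' x y := eq_of_eq_stoneCechUnit (betaExtend (x + y)).continuous
    ((betaExtend x).continuous.add (betaExtend y).continuous) (fun n => by simp) p
  map_smul' c x := eq_of_eq_stoneCechUnit (betaExtend (c • x)).continuous
    ((betaExtend x).continuous.const_mul c) (fun n => by simp) p

theorem continuous_betaLim (x : EllInfty) : Continuous fun p => betaLim p x :=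
  (betaExtend x).continuous

@[simp]
theorem betaLim_stoneCechUnit (x : EllInfty) (n : ℕ) : betaLim (stoneCechUnit n) x = x n :=
  betaExtend_stoneCechUnit x n

theorem abs_betaLim_le (p : StoneCech ℕ) (x : EllInfty) : |betaLim p x| ≤ ‖x‖ := by
  have hcl : IsClosed {p | |betaLim p x| ≤ ‖x‖} :=
    isClosed_le (continuous_betaLim x).abs continuous_const
  refine (denseRange_stoneCechUnit (α := ℕ)).induction_on p hcl fun n => ?_
  rw [betaLim_stoneCechUnit]
  exact lp.norm_apply_le_norm ENNReal.top_ne_zero x n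

theorem mem_cZero_iff (x : EllInfty) : x ∈ cZero ↔ ∀ p : OmegaStar, betaLim p x = 0 := by
  refine Iff.trans ?_ (forall_omegaStar_eq_zero_iff (betaExtend x)).symm
  simp only [betaExtend_stoneCechUnit]
  rfl

theorem isClosed_cZero : IsClosed (cZero : Set EllInfty) := by
  have : (cZero : Set EllInfty) = ⋂ p : OmegaStar, {x | betaLim p x = 0} := by
    ext x
    simp [mem_cZero_iff]
  rw [this]
  refine isClosed_iInter fun p => ?_
  let l : EllInfty →L[ℝ] ℝ := (betaLim p).mkContinuous 1 fun x => by
    rw [one_mul]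
    exact abs_betaLim_le p x
  exact isClosed_eq l.continuous continuous_const

/-- Points of `ω*` give functionals on `ℓ_∞ / c₀`. -/
def quotientLim (p : OmegaStar) : (EllInfty ⧸ cZero) →ₗ[ℝ] ℝ :=
  cZero.liftQ (betaLim p) fun x hx => (mem_cZero_iff x).1 hx p

@[simp]
theorem quotientLim_mkQ (p : OmegaStar) (x : EllInfty) :
    quotientLim p (cZero.mkQ x) = betaLim p x := cZero.liftQ_apply _ x

theorem abs_quotientLim_le (p : OmegaStar) (q : EllInfty ⧸ cZero) : |quotientLim p q| ≤ ‖q‖ := by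
  refine le_of_forall_pos_le_add fun ε hε => ?_
  obtain ⟨x, rfl, hx⟩ := Submodule.Quotient.norm_mk_lt q hε
  exact (abs_betaLim_le p x).trans hx.le

theorem mkQ_eq_iff (x : EllInfty) (q : EllInfty ⧸ cZero) :
    cZero.mkQ x = q ↔ ∀ p : OmegaStar, betaLim p x = quotientLim p q := by
  obtain ⟨z, rfl⟩ := cZero.mkQ_surjective q
  simp only [quotientLim_mkQ]
  rw [← sub_eq_zero, ← map_sub, ← LinearMap.mem_ker, Submodule.ker_mkQ, mem_cZero_iff]
  simp only [map_sub, sub_eq_zero]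

end BetaOmega

/-! ### The weak* dual ball and bounded sequences in it as operators into `ℓ_∞`. -/

section DualBall

variable {Y : Type*} [NormedAddCommGroup Y] [NormedSpace ℝ Y]

theorem isCompact_dualBall (r : ℝ) : IsCompact (dualBall Y r) := by
  have : dualBall Y r = WeakDual.toStrongDual ⁻¹' Metric.closedBall (0 : StrongDual ℝ Y) r := by
    ext φ
    simp [dualBall]
  rw [this]
  exact WeakDual.isCompact_closedBall 0 r

instance (r : ℝ) : CompactSpace (dualBall Y r) := isCompact_iff_compactSpace.1 (isCompact_dualBall r)

theorem abs_apply_le_of_mem_dualBall {r : ℝ} {φ : WeakDual ℝ Y} (hφ : φ ∈ dualBall Y r) (y : Y) :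
    |φ y| ≤ r * ‖y‖ := (WeakDual.toStrongDual φ).le_of_opNorm_le hφ y

theorem continuous_dualBall_apply {r : ℝ} (y : Y) :
    Continuous fun φ : dualBall Y r => (φ : WeakDual ℝ Y) y :=
  (WeakDual.eval_continuous y).comp continuous_subtype_val

theorem continuous_dualBall_of_apply {r : ℝ} {Z : Type*} [TopologicalSpace Z]
    {g : Z → dualBall Y r} (h : ∀ y, Continuous fun z => (g z : WeakDual ℝ Y) y) : Continuous g :=
  Continuous.subtype_mk (WeakDual.continuous_of_continuous_eval h) _

theorem exists_operator_ellInfty {r : ℝ} (hr : 0 ≤ r) (s : ℕ → StrongDual ℝ Y)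
    (hs : ∀ n, ‖s n‖ ≤ r) :
    ∃ S : Y →L[ℝ] EllInfty, (∀ y n, S y n = s n y) ∧ ‖S‖ ≤ r := by
  have hb : ∀ y n, ‖s n y‖ ≤ r * ‖y‖ := fun y n => (s n).le_of_opNorm_le (hs n) y
  let S₀ : Y →ₗ[ℝ] EllInfty :=
    { toFun := fun y => ⟨fun n => s n y, memℓp_infty ⟨r * ‖y‖, by
        rintro _ ⟨n, rfl⟩
        exact hb y n⟩⟩
      map_add' := fun y z => by ext n; exact map_add (s n) y z
      map_smul' := fun c y => by ext n; exact map_smul (s n) c y }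
  have hS₀ : ∀ y, ‖S₀ y‖ ≤ r * ‖y‖ := fun y => lp.norm_le_of_forall_le (by positivity) (hb y)
  exact ⟨S₀.mkContinuous r hS₀, fun y n => rfl, S₀.mkContinuous_norm_le hr hS₀⟩

end DualBall

/-! ### Extensions to `βω` versus liftings to `ℓ_∞`. -/

section ExtensionLifting

variable {Y : Type*} [NormedAddCommGroup Y] [NormedSpace ℝ Y] {r : ℝ}

/-- Every continuous map from `ω*` to the dual ball extends to `βω` with values in `r` times the
ball. -/
def HasBetaExtensions (Y : Type*) [NormedAddCommGroup Y] [NormedSpace ℝ Y] (r : ℝ) : Prop :=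
  ∀ f : OmegaStar → dualBall Y 1, Continuous f →
    ∃ g : StoneCech ℕ → dualBall Y r, Continuous g ∧
      ∀ p : OmegaStar, (g p : WeakDual ℝ Y) = (f p : WeakDual ℝ Y)

/-- Every operator into `ℓ_∞ / c₀` lifts to `ℓ_∞`, with norm increased by a factor at most `r`. -/
def HasLiftings (Y : Type*) [NormedAddCommGroup Y] [NormedSpace ℝ Y] (r : ℝ) : Prop :=
  ∀ T : Y →L[ℝ] EllInfty ⧸ cZero,
    ∃ S : Y →L[ℝ] EllInfty, (∀ y : Y, cZero.mkQ (S y) = T y) ∧ ‖S‖ ≤ r * ‖T‖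

theorem HasBetaExtensions.hasLiftings (hr : 0 < r) (h : HasBetaExtensions Y r) :
    HasLiftings Y r := by
  intro T
  rcases (norm_nonneg T).eq_or_lt with hT | hT
  · refine ⟨0, fun y => (mkQ_eq_iff _ _).2 fun p => ?_, by simp [← hT]⟩
    have h1 := (abs_quotientLim_le p (T y)).trans (T.le_opNorm y)
    rw [← hT, zero_mul] at h1
    rw [abs_nonpos_iff.1 h1]
    simp
  · have hb : ∀ (p : OmegaStar) (y : Y),
        ‖(‖T‖⁻¹ • (quotientLim p ∘ₗ T.toLinearMap)) y‖ ≤ 1 * ‖y‖ := by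
      intro p y
      have h1 := (abs_quotientLim_le p (T y)).trans (T.le_opNorm y)
      simp only [LinearMap.smul_apply, LinearMap.comp_apply, smul_eq_mul, norm_mul, norm_inv,
        Real.norm_of_nonneg hT.le, one_mul]
      rw [inv_mul_le_iff₀ hT]
      exact h1
    let f : OmegaStar → dualBall Y 1 := fun p =>
      ⟨StrongDual.toWeakDual (LinearMap.mkContinuous _ 1 (hb p)),
        LinearMap.mkContinuous_norm_le _ zero_le_one (hb p)⟩
    have hfy : ∀ p y, (f p : WeakDual ℝ Y) y = ‖T‖⁻¹ * quotientLim p (T y) := fun p y => rfl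
    have hf : Continuous f := by
      refine continuous_dualBall_of_apply fun y => ?_
      obtain ⟨x, hx⟩ := cZero.mkQ_surjective (T y)
      simp only [hfy, ← hx, quotientLim_mkQ]
      exact ((continuous_betaLim x).comp continuous_subtype_val).const_mul _
    obtain ⟨g, hg, hgf⟩ := h f hf
    obtain ⟨S, hS, hSr⟩ := exists_operator_ellInfty (r := r * ‖T‖) (by positivity)
      (fun n => ‖T‖ • WeakDual.toStrongDual (g (stoneCechUnit n) : WeakDual ℝ Y)) (fun n => by
        rw [norm_smul, Real.norm_of_nonneg hT.le, mul_comm]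
        gcongr
        exact (g (stoneCechUnit n)).2)
    refine ⟨S, fun y => (mkQ_eq_iff _ _).2 fun p => ?_, hSr⟩
    have h1 : betaLim p (S y) = ‖T‖ * (g p : WeakDual ℝ Y) y :=
      eq_of_eq_stoneCechUnit (continuous_betaLim (S y))
        (((continuous_dualBall_apply y).comp hg).const_mul _) (fun n => by
          rw [betaLim_stoneCechUnit, hS]; rfl) p
    rw [h1, hgf, hfy, mul_inv_cancel_left₀ hT.ne']

theorem exists_betaLim_eq (f : C(OmegaStar, ℝ)) {C : ℝ} (hC : 0 ≤ C) (hf : ∀ p, |f p| ≤ C) :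
    ∃ x : EllInfty, ‖x‖ ≤ C ∧ ∀ p : OmegaStar, betaLim p x = f p := by
  let F : BoundedContinuousFunction OmegaStar ℝ :=
    BoundedContinuousFunction.ofNormedAddCommGroup f f.continuous C hf
  obtain ⟨G, hG, hGF⟩ :=
    F.exists_extension_norm_eq_of_isClosedEmbedding isClosed_omegaStar.isClosedEmbedding_subtypeVal
  have hb : ∀ p, ‖G p‖ ≤ C := fun p => (G.norm_coe_le_norm p).trans
    (hG.trans_le (BoundedContinuousFunction.norm_ofNormedAddCommGroup_le _ hC hf))
  let x : EllInfty := ⟨fun n => G (stoneCechUnit n), memℓp_infty ⟨C, by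
    rintro _ ⟨n, rfl⟩
    exact hb _⟩⟩
  refine ⟨x, lp.norm_le_of_forall_le hC fun n => hb _, fun p => ?_⟩
  have h1 : betaLim p x = G p :=
    eq_of_eq_stoneCechUnit (continuous_betaLim x) G.continuous
      (fun n => betaLim_stoneCechUnit x n) p
  rw [h1]
  exact congrFun hGF p

theorem HasLiftings.hasBetaExtensions (hr : 0 < r) (h : HasLiftings Y r) :
    HasBetaExtensions Y r := by
  intro f hf
  have hx : ∀ y : Y, ∃ x : EllInfty, ‖x‖ ≤ ‖y‖ ∧
      ∀ p : OmegaStar, betaLim p x = (f p : WeakDual ℝ Y) y := fun y =>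
    exists_betaLim_eq ⟨_, (continuous_dualBall_apply y).comp hf⟩ (norm_nonneg y) fun p => by
      simpa using abs_apply_le_of_mem_dualBall (f p).2 y
  -- The choice of `x y` need not be linear in `y`, but its class modulo `c₀` is, being determined
  -- by the values on `ω*`.
  choose x hxn hxf using hx
  let T₀ : Y →ₗ[ℝ] EllInfty ⧸ cZero :=
    { toFun := fun y => cZero.mkQ (x y)
      map_add' := fun y z => by
        rw [mkQ_eq_iff]
        intro p
        rw [map_add, quotientLim_mkQ, quotientLim_mkQ, hxf, hxf, hxf, map_add]
      map_smul' := fun c y => by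
        rw [mkQ_eq_iff]
        intro p
        rw [RingHom.id_apply, map_smul, quotientLim_mkQ, hxf, hxf, map_smul] }
  have hT₀ : ∀ y, ‖T₀ y‖ ≤ 1 * ‖y‖ := fun y => by
    rw [one_mul]
    exact (Submodule.Quotient.norm_mk_le _ (x y)).trans (hxn y)
  obtain ⟨S, hS, hSr⟩ := h (T₀.mkContinuous 1 hT₀)
  have hSr' : ‖S‖ ≤ r := hSr.trans
    (mul_le_of_le_one_right hr.le (T₀.mkContinuous_norm_le zero_le_one hT₀))
  have hb : ∀ (p : StoneCech ℕ) (y : Y), ‖(betaLim p ∘ₗ S.toLinearMap) y‖ ≤ r * ‖y‖ := fun p y =>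
    (abs_betaLim_le p (S y)).trans (S.le_of_opNorm_le hSr' y)
  refine ⟨fun p => ⟨StrongDual.toWeakDual (LinearMap.mkContinuous _ r (hb p)),
    LinearMap.mkContinuous_norm_le _ hr.le (hb p)⟩,
    continuous_dualBall_of_apply fun y => continuous_betaLim (S y), fun p => ?_⟩
  refine DFunLike.ext _ _ fun y => ?_
  have h1 := (mkQ_eq_iff (S y) (cZero.mkQ (x y))).1 (hS y) p
  rw [quotientLim_mkQ, hxf] at h1
  exact h1

end ExtensionLifting

/-! ### Splitting of twisted sums versus liftings. -/

section Ext

theorem exists_factor_of_surjective {X Y Z : Type*} [NormedAddCommGroup X] [NormedSpace ℝ X]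
    [CompleteSpace X] [NormedAddCommGroup Y] [NormedSpace ℝ Y] [CompleteSpace Y]
    [SeminormedAddCommGroup Z] [NormedSpace ℝ Z] {p : X →L[ℝ] Y} (hp : Function.Surjective p)
    (R : X →L[ℝ] Z) (hR : ∀ x, p x = 0 → R x = 0) : ∃ R' : Y →L[ℝ] Z, ∀ x, R' (p x) = R x := by
  obtain ⟨C, hC, hpre⟩ := p.exists_preimage_norm_le hp
  choose s hs hsn using hpre
  have huniq : ∀ x x', p x = p x' → R x = R x' := fun x x' h => by
    rw [← sub_eq_zero, ← map_sub]
    exact hR _ (by rw [map_sub, h, sub_self])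
  let R₀ : Y →ₗ[ℝ] Z :=
    { toFun := fun y => R (s y)
      map_add' := fun y z => by
        rw [← map_add]
        exact huniq _ _ (by rw [map_add, hs, hs, hs])
      map_smul' := fun c y => by
        rw [RingHom.id_apply, ← map_smul]
        exact huniq _ _ (by rw [map_smul, hs, hs]) }
  refine ⟨R₀.mkContinuous (‖R‖ * C) fun y => ?_, fun x => huniq _ _ (hs _)⟩
  calc ‖R (s y)‖ ≤ ‖R‖ * ‖s y‖ := R.le_opNorm _
    _ ≤ ‖R‖ * (C * ‖y‖) := by gcongr; exact hsn y
    _ = ‖R‖ * C * ‖y‖ := by ring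

/-- `ℓ_∞` is injective: operators on `c₀` extend along isomorphic embeddings. -/
theorem exists_extension_cZero {X : Type*} [NormedAddCommGroup X] [NormedSpace ℝ X]
    [CompleteSpace X] {i : cZero →L[ℝ] X} (hi : Function.Injective i)
    (hcl : IsClosed (Set.range i)) :
    ∃ J : X →L[ℝ] EllInfty, ∀ a : cZero, J (i a) = a := by
  have : CompleteSpace cZero := isClosed_cZero.completeSpace_coe
  let E := i.equivRange hi hcl
  let coord : ℕ → StrongDual ℝ EllInfty := fun n =>
    (betaLim (stoneCechUnit n)).mkContinuous 1 fun x => by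
      rw [one_mul]
      exact abs_betaLim_le _ x
  have hcoord : ∀ n, ‖coord n‖ ≤ 1 := fun n => LinearMap.mkContinuous_norm_le _ zero_le_one _
  let A := cZero.subtypeL ∘L (E.symm : i.range →L[ℝ] cZero)
  -- Hahn–Banach in each coordinate; equal norms make the extensions uniformly bounded.
  choose ψ hψ hψn using fun n => exists_extension_norm_eq i.range (coord n ∘L A)
  obtain ⟨J, hJ, -⟩ := exists_operator_ellInfty (r := 1 * ‖A‖) (by positivity) ψ fun n => by
    rw [hψn]
    refine (ContinuousLinearMap.opNorm_comp_le _ _).trans ?_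
    gcongr
    exact hcoord n
  refine ⟨J, fun a => ?_⟩
  ext n
  have h1 : A (E a) = (a : EllInfty) := by
    simp [A]
  have h2 : (E a : X) = i a := rfl
  rw [hJ, ← h2, hψ, ContinuousLinearMap.comp_apply, h1]
  exact betaLim_stoneCechUnit _ n

variable {Y : Type u} [NormedAddCommGroup Y] [NormedSpace ℝ Y] [CompleteSpace Y]

/-- Extend the inclusion of `c₀` to `J : X → ℓ_∞`, and let `S` lift the induced operator on `Y`.
Then `J - S ∘ p` takes values in `c₀` and is the required left inverse. -/
theorem extVanishes_of_lifting (h : ∀ T : Y →L[ℝ] EllInfty ⧸ cZero,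
    ∃ S : Y →L[ℝ] EllInfty, ∀ y : Y, cZero.mkQ (S y) = T y) : ExtVanishes Y cZero := by
  intro X _ _ _ i p hip
  have hrange : Set.range i = {x | p x = 0} := by
    ext x
    exact (hip.exact x).symm
  obtain ⟨J, hJ⟩ := exists_extension_cZero hip.injective (by
    rw [hrange]
    exact isClosed_eq p.continuous continuous_const)
  obtain ⟨T, hT⟩ := exists_factor_of_surjective hip.surjective (cZero.mkQL ∘L J) (fun x hx => by
    obtain ⟨a, rfl⟩ := (hip.exact x).1 hx
    rw [ContinuousLinearMap.comp_apply, hJ]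
    exact (Submodule.Quotient.mk_eq_zero _).2 a.2)
  obtain ⟨S, hS⟩ := h T
  refine ⟨(J - S ∘L p).codRestrict cZero fun x => ?_, fun a => ?_⟩
  · rw [← Submodule.ker_mkQ cZero, LinearMap.mem_ker]
    have h1 := hS (p x)
    rw [hT] at h1
    change cZero.mkQ (J x - S (p x)) = 0
    rw [map_sub, h1]
    exact sub_self _
  · ext1
    have h1 : p (i a) = 0 := (hip.exact _).2 ⟨a, rfl⟩
    simp [hJ, h1]

theorem ExtVanishes.exists_lifting (h : ExtVanishes Y cZero) (T : Y →L[ℝ] EllInfty ⧸ cZero) :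
    ∃ S : Y →L[ℝ] EllInfty, ∀ y : Y, cZero.mkQ (S y) = T y := by
  have := isClosed_cZero
  -- The kernel of `D` is the pullback of `T` and the quotient map. Given a retraction `q` onto
  -- `c₀`, the map `(y, x) ↦ x - q (y, x)` kills `c₀` and descends to the lift.
  let D : Y × EllInfty →L[ℝ] EllInfty ⧸ cZero :=
    T ∘L ContinuousLinearMap.fst ℝ Y EllInfty - cZero.mkQL ∘L ContinuousLinearMap.snd ℝ Y EllInfty
  let E : Submodule ℝ (Y × EllInfty) := D.ker
  have hE : ∀ z : Y × EllInfty, z ∈ E ↔ T z.1 = cZero.mkQ z.2 := fun z => by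
    rw [LinearMap.mem_ker]
    exact sub_eq_zero
  have : CompleteSpace E := D.isClosed_ker.completeSpace_coe
  let i : cZero →L[ℝ] E := (ContinuousLinearMap.inr ℝ Y EllInfty ∘L cZero.subtypeL).codRestrict E
    fun a => (hE _).2 (by
      change T 0 = cZero.mkQ a
      rw [map_zero]
      exact ((Submodule.Quotient.mk_eq_zero _).2 a.2).symm)
  let p : E →L[ℝ] Y := ContinuousLinearMap.fst ℝ Y EllInfty ∘L E.subtypeL
  have hip : IsTwistedSum i p := by
    refine ⟨fun a b hab => ?_, fun z => ⟨fun hz => ?_, ?_⟩, fun y => ?_⟩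
    · have h1 := congrArg (fun z : E => z.1.2) hab
      exact Subtype.ext h1
    · have hz' : z.1.1 = 0 := hz
      have h1 := (hE z.1).1 z.2
      rw [hz', map_zero] at h1
      refine ⟨⟨z.1.2, (Submodule.Quotient.mk_eq_zero _).1 h1.symm⟩, ?_⟩
      exact Subtype.ext (Prod.ext hz'.symm rfl)
    · rintro ⟨a, rfl⟩
      rfl
    · obtain ⟨x, hx⟩ := cZero.mkQ_surjective (T y)
      exact ⟨⟨(y, x), (hE _).2 hx.symm⟩, rfl⟩
  obtain ⟨q, hq⟩ := h E i p hip
  obtain ⟨S, hS⟩ := exists_factor_of_surjective hip.surjective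
    (ContinuousLinearMap.snd ℝ Y EllInfty ∘L E.subtypeL - cZero.subtypeL ∘L q) (fun z hz => by
      obtain ⟨a, rfl⟩ := (hip.exact z).1 hz
      change (a : EllInfty) - (q (i a) : EllInfty) = 0
      rw [hq, sub_self])
  refine ⟨S, fun y => ?_⟩
  obtain ⟨z, rfl⟩ := hip.surjective y
  rw [hS]
  change cZero.mkQ (z.1.2 - (q z : EllInfty)) = T z.1.1
  rw [map_sub, (hE z.1).1 z.2, sub_eq_self]
  exact (Submodule.Quotient.mk_eq_zero _).2 (q z).2

-- Composition with the quotient map is a surjection between Banach spaces of operators, so the open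
-- mapping theorem supplies the constant.
omit [CompleteSpace Y] in
theorem exists_lifting_norm_le {M : Type*} [NormedAddCommGroup M] [NormedSpace ℝ M]
    [CompleteSpace M] (N : Submodule ℝ M) (hN : IsClosed (N : Set M))
    (h : ∀ T : Y →L[ℝ] M ⧸ N, ∃ S : Y →L[ℝ] M, ∀ y, N.mkQ (S y) = T y) :
    ∃ r : ℝ, 0 < r ∧ ∀ T : Y →L[ℝ] M ⧸ N,
      ∃ S : Y →L[ℝ] M, (∀ y, N.mkQ (S y) = T y) ∧ ‖S‖ ≤ r * ‖T‖ := by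
  have hsurj : Function.Surjective (ContinuousLinearMap.compL ℝ Y M (M ⧸ N) N.mkQL) := fun T => by
    obtain ⟨S, hS⟩ := h T
    exact ⟨S, ContinuousLinearMap.ext hS⟩
  obtain ⟨C, hC, hpre⟩ := ContinuousLinearMap.exists_preimage_norm_le _ hsurj
  refine ⟨C, hC, fun T => ?_⟩
  obtain ⟨S, rfl, hSn⟩ := hpre T
  exact ⟨S, fun y => rfl, hSn⟩

theorem ExtVanishes.exists_hasLiftings (h : ExtVanishes Y cZero) :
    ∃ r : ℝ, 0 < r ∧ HasLiftings Y r :=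
  exists_lifting_norm_le cZero isClosed_cZero h.exists_lifting

end Ext

/-! ### Gluing `βω` to a compact space along `ω*`. -/

section Pushout

variable {K : Type u}

/-- The space obtained from `βω` by gluing the remainder `ω*` to `K` along `f`. -/
def OmegaPushout (_f : OmegaStar → K) : Type u := K ⊕ ℕ

namespace OmegaPushout

variable (f : OmegaStar → K)

open Classical in
/-- The quotient map from the disjoint union of `βω` and `K`. -/
def proj : StoneCech ℕ ⊕ K → OmegaPushout f :=
  Sum.elim (fun p => if h : p ∈ Set.range stoneCechUnit then Sum.inr h.choose else Sum.inl (f ⟨p, h⟩))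
    Sum.inl

/-- The inclusion of `K`. -/
def incl : K → OmegaPushout f := Sum.inl

/-- The isolated points. -/
def point : ℕ → OmegaPushout f := Sum.inr

@[simp]
theorem proj_inr (b : K) : proj f (Sum.inr b) = incl f b := rfl

@[simp]
theorem proj_stoneCechUnit (n : ℕ) : proj f (Sum.inl (stoneCechUnit n)) = point f n := by
  have h : stoneCechUnit n ∈ Set.range (stoneCechUnit : ℕ → StoneCech ℕ) := ⟨n, rfl⟩
  exact (dif_pos h).trans (congrArg Sum.inr (stoneCechUnit_nat_injective h.choose_spec))

@[simp]
theorem proj_omegaStar (p : OmegaStar) : proj f (Sum.inl (p : StoneCech ℕ)) = incl f (f p) := by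
  have h : (p : StoneCech ℕ) ∉ Set.range (stoneCechUnit : ℕ → StoneCech ℕ) := p.2
  exact dif_neg h

theorem incl_injective : Function.Injective (incl f) := Sum.inl_injective

theorem point_injective : Function.Injective (point f) := Sum.inr_injective

theorem incl_ne_point (b : K) (n : ℕ) : incl f b ≠ point f n := Sum.inl_ne_inr

theorem range_incl_compl : (Set.range (incl f))ᶜ = Set.range (point f) :=
  Set.isCompl_range_inl_range_inr.compl_eq

theorem exists_incl_or_point (x : OmegaPushout f) : (∃ b, x = incl f b) ∨ ∃ n, x = point f n := by
  rcases x with b | n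
  · exact Or.inl ⟨b, rfl⟩
  · exact Or.inr ⟨n, rfl⟩

theorem proj_surjective : Function.Surjective (proj f) := by
  intro x
  rcases exists_incl_or_point f x with ⟨b, rfl⟩ | ⟨n, rfl⟩
  · exact ⟨Sum.inr b, rfl⟩
  · exact ⟨_, proj_stoneCechUnit f n⟩

theorem preimage_singleton_point (n : ℕ) :
    proj f ⁻¹' {point f n} = Sum.inl '' {stoneCechUnit n} := by
  ext u
  rw [Set.image_singleton]
  rcases u with p | b
  · by_cases hp : p ∈ Set.range (stoneCechUnit : ℕ → StoneCech ℕ)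
    · obtain ⟨m, rfl⟩ := hp
      simp [(point_injective f).eq_iff, stoneCechUnit_nat_injective.eq_iff]
    · have h1 := proj_omegaStar f ⟨p, hp⟩
      simp only at h1
      have h2 : p ≠ stoneCechUnit n := fun h => hp ⟨n, h.symm⟩
      simp [h1, incl_ne_point, h2]
  · simp [incl_ne_point]

variable [TopologicalSpace K]

instance : TopologicalSpace (OmegaPushout f) := TopologicalSpace.coinduced (proj f) inferInstance

theorem isQuotientMap_proj : IsQuotientMap (proj f) := ⟨⟨rfl⟩, proj_surjective f⟩

theorem continuous_incl : Continuous (incl f) :=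
  (isQuotientMap_proj f).continuous.comp continuous_inr

theorem isOpen_singleton_point (n : ℕ) : IsOpen {point f n} := by
  rw [← (isQuotientMap_proj f).isOpen_preimage, preimage_singleton_point]
  exact isOpenMap_inl _ (isOpen_singleton_stoneCechUnit n)

theorem isClosed_singleton_point (n : ℕ) : IsClosed {point f n} := by
  rw [← (isQuotientMap_proj f).isClosed_preimage, preimage_singleton_point]
  exact isClosedMap_inl _ isClosed_singleton

instance [CompactSpace K] : CompactSpace (OmegaPushout f) :=
  (isQuotientMap_proj f).surjective.compactSpace (isQuotientMap_proj f).continuous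

variable {f}

/-- Tietze extends `h ∘ f` from `ω*` to `βω`, and the result glues with `h`. This is what separates
points of `K` in the pushout. -/
theorem exists_continuous_extension (hf : Continuous f) (h : C(K, ℝ)) :
    ∃ H : C(OmegaPushout f, ℝ), ∀ b, H (incl f b) = h b := by
  obtain ⟨G, hG⟩ := ContinuousMap.exists_restrict_eq isClosed_omegaStar (h.comp ⟨f, hf⟩)
  have hG' : ∀ p : OmegaStar, G p = h (f p) := fun p =>
    congrArg (fun F : C(OmegaStar, ℝ) => F p) hG
  let H : OmegaPushout f → ℝ := Sum.elim h fun n => G (stoneCechUnit n)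
  have hH : H ∘ proj f = Sum.elim G h := by
    funext u
    rcases u with p | b
    · by_cases hp : p ∈ Set.range (stoneCechUnit : ℕ → StoneCech ℕ)
      · obtain ⟨m, rfl⟩ := hp
        simp only [Function.comp, proj_stoneCechUnit]
        rfl
      · have h1 := proj_omegaStar f ⟨p, hp⟩
        simp only at h1
        simp only [Function.comp, h1]
        exact (hG' ⟨p, hp⟩).symm
    · rfl
  refine ⟨⟨H, (isQuotientMap_proj f).continuous_iff.2 ?_⟩, fun b => rfl⟩
  rw [hH]
  exact G.continuous.sumElim h.continuous

theorem t2Space [CompactSpace K] [T2Space K] (hf : Continuous f) : T2Space (OmegaPushout f) := by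
  have hpt : ∀ (n : ℕ) (y : OmegaPushout f), point f n ≠ y →
      ∃ u v : Set (OmegaPushout f), IsOpen u ∧ IsOpen v ∧ point f n ∈ u ∧ y ∈ v ∧ Disjoint u v :=
    fun n y hy => ⟨{point f n}, {point f n}ᶜ, isOpen_singleton_point f n,
      (isClosed_singleton_point f n).isOpen_compl, rfl, fun h => hy h.symm, disjoint_compl_right⟩
  refine ⟨fun x y hxy => ?_⟩
  rcases exists_incl_or_point f x with ⟨b, rfl⟩ | ⟨n, rfl⟩
  · rcases exists_incl_or_point f y with ⟨b', rfl⟩ | ⟨n, rfl⟩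
    · have hne : b ≠ b' := fun h => hxy (h ▸ rfl)
      obtain ⟨h, h0, h1, -⟩ := exists_continuous_zero_one_of_isClosed
        (isClosed_singleton (x := b)) (isClosed_singleton (x := b')) (by simpa using hne)
      obtain ⟨H, hH⟩ := exists_continuous_extension hf h
      refine separated_by_continuous H.continuous ?_
      rw [hH, hH, h0 rfl, h1 rfl]
      simp
    · obtain ⟨u, v, hu, hv, hx, hy, huv⟩ := hpt n _ hxy.symm
      exact ⟨v, u, hv, hu, hy, hx, huv.symm⟩
  · exact hpt n y hxy

theorem isCountableDiscreteExtension [CompactSpace K] [T2Space K] (hf : Continuous f) :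
    IsCountableDiscreteExtension (incl f) := by
  have := t2Space hf
  refine ⟨inferInstance, this,
    ((continuous_incl f).isClosedEmbedding (incl_injective f)).isEmbedding, ?_, ?_, ?_⟩
  · rw [range_incl_compl]
    exact Set.countable_range _
  · rw [range_incl_compl]
    exact Set.infinite_range_of_injective (point_injective f)
  · rw [range_incl_compl, isDiscrete_iff_forall_mem_exists_isOpen]
    rintro _ ⟨n, rfl⟩
    exact ⟨_, isOpen_singleton_point f n, Set.inter_eq_left.2 (by simp)⟩

end OmegaPushout

end Pushout

/-! ### Realizing countable discrete extensions inside a larger ball. -/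

section Realization

variable {Y : Type u} [NormedAddCommGroup Y] [NormedSpace ℝ Y]

/-- Every countable discrete extension of the dual ball can be realized inside `r` times the
ball. -/
def RealizesExtensions (Y : Type u) [NormedAddCommGroup Y] [NormedSpace ℝ Y] (r : ℝ) : Prop :=
  ∃ h : dualBall Y 1 ⊆ dualBall Y r, ∀ (L : Type u) [TopologicalSpace L] (e : dualBall Y 1 → L),
    IsCountableDiscreteExtension e → CanBeRealizedInside e (Set.inclusion h)

theorem RealizesExtensions.hasBetaExtensions {r : ℝ} (h : RealizesExtensions Y r) :
    HasBetaExtensions Y r := by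
  intro f hf
  obtain ⟨hsub, h⟩ := h
  obtain ⟨G, hG, hGe⟩ := h _ _ (OmegaPushout.isCountableDiscreteExtension hf)
  refine ⟨fun p => G (OmegaPushout.proj f (Sum.inl p)), ?_, fun p => ?_⟩
  · exact hG.continuous.comp ((OmegaPushout.isQuotientMap_proj f).continuous.comp continuous_inl)
  · simp only [OmegaPushout.proj_omegaStar, hGe]

/-- A perturbation making a bounded sequence injective and moving it off the unit ball. -/
theorem exists_injective_perturbation {r : ℝ} (hr : 0 ≤ r) {b z : ℕ → StrongDual ℝ Y}
    (hb : ∀ n, ‖b n‖ ≤ r) (hz : ∀ n, ‖z n‖ = r + 3) :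
    ∃ t : ℕ → ℝ, (∀ n, 1 ≤ t n ∧ t n ≤ 2) ∧
      Function.Injective (fun n => b n + t n • z n) ∧
      (∀ n, 1 < ‖b n + t n • z n‖) ∧ ∀ n, ‖b n + t n • z n‖ ≤ 3 * r + 6 := by
  -- Take `t n = 1 + s * (1 / 2) ^ n`. Two bad `s` for one pair `m ≠ n` would give `z m` and `z n`,
  -- scaled by distinct powers of `1 / 2`, equal norms. So only countably many `s` are bad. The norm
  -- `r + 3` of `z n` puts the new norms between `(r + 3) - r` and `r + 2 * (r + 3)`.
  let bad : ℕ × ℕ → Set ℝ := fun k => {s | k.1 ≠ k.2 ∧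
    b k.1 + (1 + s * (1 / 2) ^ k.1) • z k.1 = b k.2 + (1 + s * (1 / 2) ^ k.2) • z k.2}
  have hbad : ∀ k, (bad k).Countable := by
    rintro ⟨m, n⟩
    refine Set.Subsingleton.countable ?_
    rintro s ⟨hmn, hs⟩ s' ⟨-, hs'⟩
    by_contra hne
    have h1 : (s - s') • ((1 / 2 : ℝ) ^ m • z m) = (s - s') • ((1 / 2 : ℝ) ^ n • z n) := by
      simp only at hs hs'
      linear_combination (norm := module) hs - hs'
    have h2 := congrArg norm (smul_right_injective _ (sub_ne_zero.2 hne) h1)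
    rw [norm_smul, norm_smul, hz, hz, mul_left_inj' (by positivity), norm_pow, norm_pow] at h2
    exact hmn (pow_right_injective₀ (by norm_num) (by norm_num) h2)
  obtain ⟨s, hs, hs01⟩ := ((Set.countable_iUnion hbad).dense_compl ℝ).exists_between
    (zero_lt_one (α := ℝ))
  have ht : ∀ n : ℕ, 1 ≤ 1 + s * (1 / 2) ^ n ∧ 1 + s * (1 / 2) ^ n ≤ 2 := by
    intro n
    have h1 : (0 : ℝ) < (1 / 2) ^ n := by positivity
    have h2 : ((1 : ℝ) / 2) ^ n ≤ 1 := pow_le_one₀ (by norm_num) (by norm_num)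
    constructor <;> nlinarith [hs01.1, hs01.2]
  refine ⟨fun n => 1 + s * (1 / 2) ^ n, ht, fun m n hmn => ?_, fun n => ?_, fun n => ?_⟩
  · by_contra hne
    exact hs (Set.mem_iUnion.2 ⟨(m, n), hne, hmn⟩)
  all_goals
    have h1 : ‖(1 + s * (1 / 2) ^ n) • z n‖ = (1 + s * (1 / 2) ^ n) * (r + 3) := by
      rw [norm_smul, hz, Real.norm_of_nonneg (by linarith [(ht n).1])]
    have h2 := hb n
    have h3 := ht n
  · have h4 := norm_sub_norm_le ((1 + s * (1 / 2) ^ n) • z n) (-b n)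
    rw [norm_neg, sub_neg_eq_add, add_comm _ (b n), h1] at h4
    nlinarith
  · refine (norm_add_le _ _).trans ?_
    rw [h1]
    nlinarith

theorem exists_weakStarNull_seq_norm_eq (hY : ¬ FiniteDimensional ℝ Y) {R : ℝ} (hR : 0 ≤ R) :
    ∃ z : ℕ → StrongDual ℝ Y, (∀ n, ‖z n‖ = R) ∧ ∀ y, Tendsto (fun n => z n y) atTop (𝓝 0) := by
  obtain ⟨w, c, hc, hw, hnull⟩ := exists_weakStarNull_seq hY
  refine ⟨fun n => (R / ‖w n‖) • w n, fun n => ?_, fun y => ?_⟩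
  · have h1 : 0 < ‖w n‖ := hc.trans_le (hw n)
    rw [norm_smul, norm_div, norm_norm, Real.norm_of_nonneg hR, div_mul_cancel₀ _ h1.ne']
  · refine squeeze_zero_norm (a := fun n => R / c * |w n y|) (fun n => ?_) ?_
    · rw [smul_apply, smul_eq_mul, norm_mul, norm_div, norm_norm, Real.norm_of_nonneg hR]
      have := hw n
      gcongr
      exact le_rfl
    · simpa using (hnull y).abs.const_mul (R / c)

theorem HasBetaExtensions.realizesExtensions (hY : ¬ FiniteDimensional ℝ Y) {r : ℝ} (hr : 0 < r)
    (h : HasBetaExtensions Y r) : RealizesExtensions Y (3 * r + 6) := by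
  obtain ⟨z, hz, hnull⟩ := exists_weakStarNull_seq_norm_eq hY (R := r + 3) (by positivity)
  have hsub : dualBall Y 1 ⊆ dualBall Y (3 * r + 6) := fun φ hφ =>
    (show ‖WeakDual.toStrongDual φ‖ ≤ 1 from hφ).trans (by linarith)
  refine ⟨hsub, fun L _ e he => ?_⟩
  have := he.compactSpace
  have := he.t2Space
  have := he.countable.to_subtype
  have := he.infinite.to_subtype
  obtain ⟨hden⟩ := nonempty_denumerable ((Set.range e)ᶜ : Set L)
  let d : ℕ → L := fun n => (Denumerable.eqv ((Set.range e)ᶜ : Set L)).symm n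
  have hd : Function.Injective d :=
    Subtype.val_injective.comp (Denumerable.eqv ((Set.range e)ᶜ : Set L)).symm.injective
  have hde : ∀ n k, d n ≠ e k := fun n k hnk =>
    ((Denumerable.eqv ((Set.range e)ᶜ : Set L)).symm n).2 ⟨k, hnk.symm⟩
  have hcover : ∀ l, (∃ k, e k = l) ∨ ∃ n, d n = l := by
    intro l
    by_cases hl : l ∈ Set.range e
    · exact Or.inl hl
    · exact Or.inr ⟨Denumerable.eqv ((Set.range e)ᶜ : Set L) ⟨l, hl⟩, by simp [d]⟩
  have hopen : ∀ n, IsOpen {d n} := by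
    intro n
    obtain ⟨U, hU, hUd⟩ := isDiscrete_iff_forall_mem_exists_isOpen.1 he.discrete (d n)
      ((Denumerable.eqv ((Set.range e)ᶜ : Set L)).symm n).2
    rw [← hUd]
    exact hU.inter (isCompact_range he.isEmbedding.continuous).isClosed.isOpen_compl
  have hdc : Continuous d := continuous_of_discreteTopology
  let φ : StoneCech ℕ → L := stoneCechExtend hdc
  have hφ : Continuous φ := continuous_stoneCechExtend hdc
  have hφd : ∀ n, φ (stoneCechUnit n) = d n := stoneCechExtend_stoneCechUnit hdc
  have hφe : ∀ p : OmegaStar, ∃ k, e k = φ p := by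
    -- Each `d n` is isolated and hit by only one integer, so its preimage under `φ` is an open set
    -- with finite trace and misses `ω*`.
    rintro ⟨p, hp⟩
    rcases hcover (φ p) with hk | ⟨n, hn⟩
    · exact hk
    · exfalso
      have hfin : (stoneCechUnit ⁻¹' (φ ⁻¹' {d n}) : Set ℕ).Finite := by
        refine (Set.finite_singleton n).subset fun m hm => ?_
        have hm' : φ (stoneCechUnit m) = d n := hm
        exact hd ((hφd m).symm.trans hm')
      obtain ⟨m, -, hm⟩ := subset_range_stoneCechUnit_image ((hopen n).preimage hφ) hfin hn.symm
      exact hp ⟨m, hm⟩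
  choose f hf using hφe
  have hfc : Continuous f := by
    rw [he.isEmbedding.continuous_iff]
    exact (hφ.comp continuous_subtype_val).congr fun p => (hf p).symm
  obtain ⟨g, hg, hgf⟩ := h f hfc
  obtain ⟨t, ht, hinj, hout, hin⟩ := exists_injective_perturbation hr.le
    (b := fun n => WeakDual.toStrongDual (g (stoneCechUnit n) : WeakDual ℝ Y))
    (fun n => (g (stoneCechUnit n)).2) hz
  let a : ℕ → dualBall Y (3 * r + 6) := fun n => ⟨StrongDual.toWeakDual _, hin n⟩
  have hac : Continuous a := continuous_of_discreteTopology
  let A : StoneCech ℕ → dualBall Y (3 * r + 6) := stoneCechExtend hac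
  have hA : Continuous A := continuous_stoneCechExtend hac
  have hAa : ∀ n, A (stoneCechUnit n) = a n := stoneCechExtend_stoneCechUnit hac
  have hAf : ∀ p : OmegaStar, A p = Set.inclusion hsub (f p) := by
    intro p
    refine Subtype.ext (DFunLike.ext _ _ fun y => ?_)
    let D : C(StoneCech ℕ, ℝ) := ⟨fun q => (A q : WeakDual ℝ Y) y - (g q : WeakDual ℝ Y) y,
      ((continuous_dualBall_apply y).comp hA).sub ((continuous_dualBall_apply y).comp hg)⟩
    have hD : ∀ n, D (stoneCechUnit n) = t n * z n y := by
      intro n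
      change (A (stoneCechUnit n) : WeakDual ℝ Y) y - (g (stoneCechUnit n) : WeakDual ℝ Y) y = _
      rw [hAa]
      exact add_sub_cancel_left _ _
    have h0 : D p = 0 := by
      refine (forall_omegaStar_eq_zero_iff D).2 ?_ p
      simp only [hD]
      refine squeeze_zero_norm (a := fun n => 2 * |z n y|) (fun n => ?_) ?_
      · rw [norm_mul, Real.norm_of_nonneg (by linarith [(ht n).1])]
        exact mul_le_mul_of_nonneg_right (ht n).2 (norm_nonneg _)
      · simpa using (hnull y).abs.const_mul 2
    have h1 : (A p : WeakDual ℝ Y) y = (g p : WeakDual ℝ Y) y := sub_eq_zero.1 h0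
    rw [h1, hgf]
  -- `L` is a quotient of the sum of `βω` and the ball via `P`. Since `H` has the same fibres as
  -- `P`, it descends to an injective continuous map on `L`, an embedding by compactness.
  let P : C(StoneCech ℕ ⊕ dualBall Y 1, L) :=
    ⟨Sum.elim φ e, hφ.sumElim he.isEmbedding.continuous⟩
  let H : C(StoneCech ℕ ⊕ dualBall Y 1, dualBall Y (3 * r + 6)) :=
    ⟨Sum.elim A (Set.inclusion hsub), hA.sumElim (continuous_inclusion hsub)⟩
  have hPsurj : Function.Surjective P := by
    intro l
    rcases hcover l with ⟨k, rfl⟩ | ⟨n, rfl⟩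
    · exact ⟨Sum.inr k, rfl⟩
    · exact ⟨Sum.inl (stoneCechUnit n), hφd n⟩
  have hPq : IsQuotientMap P := P.continuous.isClosedMap.isQuotientMap P.continuous hPsurj
  have hcase : ∀ u, (∃ n, P u = d n ∧ H u = a n) ∨
      ∃ k, P u = e k ∧ H u = Set.inclusion hsub k := by
    rintro (p | k)
    · by_cases hp : p ∈ Set.range (stoneCechUnit : ℕ → StoneCech ℕ)
      · obtain ⟨n, rfl⟩ := hp
        exact Or.inl ⟨n, hφd n, hAa n⟩
      · exact Or.inr ⟨f ⟨p, hp⟩, (hf ⟨p, hp⟩).symm, hAf ⟨p, hp⟩⟩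
    · exact Or.inr ⟨k, rfl, rfl⟩
  have hiff : ∀ u v, P u = P v ↔ H u = H v := by
    have hainj : Function.Injective a := fun m n hmn =>
      hinj (StrongDual.toWeakDual.injective (Subtype.ext_iff.1 hmn))
    have hane : ∀ n k, a n ≠ Set.inclusion hsub k := by
      intro n k hnk
      have h1 : ‖WeakDual.toStrongDual (a n : WeakDual ℝ Y)‖ ≤ 1 := by
        rw [hnk]
        exact k.2
      exact absurd h1 (not_le.2 (hout n))
    intro u v
    rcases hcase u with ⟨n, h1, h2⟩ | ⟨k, h1, h2⟩ <;>
    rcases hcase v with ⟨n', h1', h2'⟩ | ⟨k', h1', h2'⟩ <;> rw [h1, h2, h1', h2']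
    · rw [hd.eq_iff, hainj.eq_iff]
    · exact ⟨fun h => absurd h (hde _ _), fun h => absurd h (hane _ _)⟩
    · exact ⟨fun h => absurd h.symm (hde _ _), fun h => absurd h.symm (hane _ _)⟩
    · rw [he.isEmbedding.injective.eq_iff, (Set.inclusion_injective hsub).eq_iff]
  let G := hPq.lift H fun u v huv => (hiff u v).1 huv
  have hG : ∀ u, G (P u) = H u := fun u =>
    congrArg (fun F : C(_, _) => F u) (hPq.lift_comp H fun u v huv => (hiff u v).1 huv)
  refine ⟨G, (G.continuous.isClosedEmbedding fun l l' hl => ?_).isEmbedding, fun k => hG (Sum.inr k)⟩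
  obtain ⟨u, rfl⟩ := hPsurj l
  obtain ⟨v, rfl⟩ := hPsurj l'
  rw [hG, hG] at hl
  exact (hiff u v).2 hl

end Realization

end

theorem theorem3p2 (Y : Type u) [NormedAddCommGroup Y] [NormedSpace ℝ Y] [CompleteSpace Y]
    (hY : ¬ FiniteDimensional ℝ Y) :
    List.TFAE [
      ExtVanishes Y cZero,
      ∃ r : ℝ, 0 < r ∧ ∃ h : dualBall Y 1 ⊆ dualBall Y r,
        ∀ (L : Type u) [TopologicalSpace L] (e : dualBall Y 1 → L),
          IsCountableDiscreteExtension e → CanBeRealizedInside e (Set.inclusion h),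
      ∃ r : ℝ, 0 < r ∧ ∀ f : OmegaStar → dualBall Y 1, Continuous f →
        ∃ g : StoneCech ℕ → dualBall Y r, Continuous g ∧
          ∀ p : OmegaStar, (g p : WeakDual ℝ Y) = (f p : WeakDual ℝ Y),
      ∃ r : ℝ, 0 < r ∧ ∀ T : Y →L[ℝ] EllInfty ⧸ cZero,
        ∃ S : Y →L[ℝ] EllInfty, (∀ y : Y, cZero.mkQ (S y) = T y) ∧ ‖S‖ ≤ r * ‖T‖] := by
  tfae_have 1 → 4 := fun h => h.exists_hasLiftings
  tfae_have 4 → 1 := fun ⟨r, _, h⟩ => extVanishes_of_lifting fun T =>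
    (h T).imp fun S hS => hS.1
  tfae_have 4 → 3 := fun ⟨r, hr, h⟩ => ⟨r, hr, HasLiftings.hasBetaExtensions hr h⟩
  tfae_have 3 → 4 := fun ⟨r, hr, h⟩ => ⟨r, hr, HasBetaExtensions.hasLiftings hr h⟩
  tfae_have 2 → 3 := fun ⟨r, hr, h⟩ => ⟨r, hr, RealizesExtensions.hasBetaExtensions h⟩
  tfae_have 3 → 2 := fun ⟨r, hr, h⟩ =>
    ⟨3 * r + 6, by positivity, HasBetaExtensions.realizesExtensions hY hr h⟩
  tfae_finish
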